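/- **Setting.** Let $d\ge 1$, $T>0$, let $\Theta\subset\mathbb R^d$ be open and bounded, and $\Theta_T=(0,T)\times\Theta$. * $\zeta:\mathbb R\to\mathbb R$ is nondecreasing and Lipschitz continuous with constant $L_\zeta^{-1}$ ($L_\zeta>0$), $\zeta(0)=0$, and $|\zeta(s)|\ge c|s|-b$ for all $s$, for some $c,b>0$. Put $\Xi(z)=\int_0^z\zeta(s)\,ds$. * $\Lambda$ is a measurable, symmetric matrix field on $\Theta$ with $\underline\mu|\xi|^2\le\Lambda(x)\xi\cdot\xi\le\overline\mu|\xi|^2$ for all $\xi\in\mathbb R^d$ and a.e. $x\in\Theta$, where $0<\underline\mu\le\overline\mu<\infty$; $\|F\|_\Lambda^2=\int_\Theta\Lambda F\cdot F$. * $u_0:\Theta\to\mathbb R$ is measurable with $\Xi(u_0)\in L^1(\Theta)$ (hence $u_0\in L^2(\Theta)$). * $\mathcal K$ is a separable Hilbert space with orthonormal basis $(e_k)$, $(q_k)$ are reals with $\sum_k q_k^2<\infty$, and $f:L^2(\Theta)\to\mathcal L(\mathcal K,L^2(\Theta))$ is continuous, where $\mathcal L(\mathcal K,L^2(\Theta))$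 is the space of Hilbert–Schmidt operators with the Hilbert–Schmidt norm. For some $C_1,C_2>0$, $\|f(\zeta(w))\|^2_{\mathcal L(\mathcal K,L^2(\Theta))}\le C_2\int_\Theta\Xi(w)\,dx+C_1$ for all $w\in L^2(\Theta)$ with $\Xi(w)\in L^1(\Theta)$. * On a probability space $(\Omega,\mathcal F,\mathbb P)$ with a filtration $\mathbb F=(\mathcal F_t)_{t\in[0,T]}$, $W(t)=\sum_k q_kW_k(t)e_k$ is a continuous $\mathbb F$-adapted $\mathcal K$-valued Wiener process, where the $W_k$ are independent $\mathbb F$-adapted real standard Wiener processes. **Gradient discretisations.** Let $Y=\{v\in L^2(\Theta):\zeta(v)\in H^1_0(\Theta)\}$ and fix a set $\mathcal Y$ with $Y\cup\{u_0\}\subset\mathcal Y\subset L^2(\Theta)$, the domain of the interpolation operators (for instance $\mathcal Y=L^2(\Theta)$, or $\mathcal Y=Y$ if $u_0\in Y$). A space-time gradient discretisation $\mathcal D$ consists of: a finite-dimensional real space $X_{\mathcal D}$ with a basis $(\mathbf e_i)_{i\in B}$; pairwise disjoint measurable sets $\Theta_i\subset\Theta$ ($i\in B$), with $\Pi_{\mathcal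 D}v=\sum_i v_i\mathbf 1_{\Theta_i}$ for $v=\sum_iv_i\mathbf e_i$; a linear map $\nabla_{\mathcal D}:X_{\mathcal D}\to L^2(\Theta)^d$ such that $v\mapsto\|\nabla_{\mathcal D}v\|_{L^2(\Theta)}$ is a norm; a map $\mathcal I_{\mathcal D}:\mathcal Y\to X_{\mathcal D}$; and the times $t^{(n)}=n\,\delta t_{\mathcal D}$, $0\le n\le N$, with $\delta t_{\mathcal D}=T/N$, $N\ge1$. Put $\zeta(v)=\sum_i\zeta(v_i)\mathbf e_i$. For $v=(v^{(n)})_{0\le n\le N}\in X_{\mathcal D}^{N+1}$ put $\zeta(v)=(\zeta(v^{(n)}))_{0\le n\le N}$, and let $\Pi_{\mathcal D}v(t)=\Pi_{\mathcal D}v^{(n+1)}$ and $\nabla_{\mathcal D}v(t)=\nabla_{\mathcal D}v^{(n+1)}$ for $t\in(t^{(n)},t^{(n+1)}]$, and $\Pi_{\mathcal D}v(0)=\Pi_{\mathcal D}v^{(0)}$. Let $(\mathcal D_m)_{m\in\mathbb N}$ be a sequence of such gradient discretisations which is * *consistent*: $\min_{w\in X_{\mathcal D_m}}\big(\|\Pi_{\mathcal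 D_m}w-\phi\|_{L^2}+\|\nabla_{\mathcal D_m}w-\nabla\phi\|_{L^2}\big)\to0$ for every $\phi\in H^1_0(\Theta)$; for every $\phi\in\mathcal Y$, $\Pi_{\mathcal D_m}\mathcal I_{\mathcal D_m}\phi\to\phi$ in $L^2(\Theta)$ and $\delta t_{\mathcal D_m}\|\nabla_{\mathcal D_m}\zeta(\mathcal I_{\mathcal D_m}\phi)\|_\Lambda$ is bounded in $m$; and $\delta t_{\mathcal D_m}\to0$; * *limit-conforming*: for every $\boldsymbol\phi\in L^2(\Theta)^d$ with weak divergence $\operatorname{div}\boldsymbol\phi\in L^2(\Theta)$, $\max_{v\ne0}\dfrac{|\langle\nabla_{\mathcal D_m}v,\boldsymbol\phi\rangle+\langle\Pi_{\mathcal D_m}v,\operatorname{div}\boldsymbol\phi\rangle|}{\|\nabla_{\mathcal D_m}v\|_{L^2}}\to0$; * *compact*: $\displaystyle\lim_{\xi\to0}\sup_m\max_{v\neq0}\frac{\|\Pi_{\mathcal D_m}v(\cdot+\xi)-\Pi_{\mathcal D_m}v\|_{L^2(\mathbb R^d)}}{\|\nabla_{\mathcal D_m}v\|_{L^2(\Theta)}}=0$,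 where $\Pi_{\mathcal D_m}v$ is extended by $0$ outside $\Theta$. **Scheme.** A solution of the gradient scheme for $\mathcal D$ is a family of random variables $u=(u^{(n)})_{0\le n\le N}$ in $X_{\mathcal D}$ such that $u^{(0)}=\mathcal I_{\mathcal D}u_0$, $u^{(n)}$ is $\sigma\{W(t^{(k)}):0\le k\le n\}$-measurable, and, for every $\phi\in X_{\mathcal D}$, almost surely, for $n=0,\dots,N-1$, $$\langle\Pi_{\mathcal D}u^{(n+1)}-\Pi_{\mathcal D}u^{(n)},\Pi_{\mathcal D}\phi\rangle+\delta t_{\mathcal D}\langle\Lambda\nabla_{\mathcal D}\zeta(u^{(n+1)}),\nabla_{\mathcal D}\phi\rangle=\big\langle f(\Pi_{\mathcal D}\zeta(u^{(n)}))\,(W(t^{(n+1)})-W(t^{(n)})),\Pi_{\mathcal D}\phi\big\rangle,$$ with $\langle\cdot,\cdot\rangle$ the inner product of $L^2(\Theta)$ or $L^2(\Theta)^d$. **Lemma (higher moment estimates).** There is a constant $C>0$, depending only on the data $d,\Theta,T,\zeta,\Lambda,u_0,\mathcal K,(e_k),(q_k),f$ and on the sequence $(\mathcal D_m)_m$ (in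 particular not on $m$, nor on the stochastic basis, nor on $W$, nor on $u$), such that for every $m$ and every solution $u$ of the gradient scheme for $\mathcal D=\mathcal D_m$, $$\mathbb E\Big[\max_{0\le n\le N}\Big(\int_\Theta\Xi(\Pi_{\mathcal D}u^{(n)})\,dx\Big)^2+\|\nabla_{\mathcal D}\zeta(u)\|^4_{L^2(\Theta_T)}\Big]\le C ,$$ and, for every real $r$ with $0\le r\le4$, $$\mathbb E\Big[\|\Pi_{\mathcal D}u\|^r_{L^\infty(0,T;L^2(\Theta))}\Big]\le C .$$ -/

import Mathlib

open MeasureTheory ProbabilityTheory Filter Topology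
open scoped NNReal ENNReal RealInnerProductSpace

noncomputable section

namespace StochStefan

/-- The physical space `ℝ^d` with its Euclidean norm. -/
abbrev Space (d : ℕ) : Type := EuclideanSpace ℝ (Fin d)

/-- The primitive `Ξ(z) = ∫₀^z ζ(s) ds`. -/
def Xi (ζ : ℝ → ℝ) (z : ℝ) : ℝ := ∫ s in (0 : ℝ)..z, ζ s

/-! ### Deterministic data -/

/-- The deterministic data: domain `Θ`, final time `T`, nonlinearity `ζ` (with Lipschitz
constant `Lζ⁻¹`), diffusion tensor `Λ`, initial condition `u0`, and their standing assumptions. -/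
structure StefanData (d : ℕ) where
  Θ : Set (Space d)
  isOpen : IsOpen Θ
  bounded : Bornology.IsBounded Θ
  T : ℝ
  T_pos : 0 < T
  ζ : ℝ → ℝ
  Lζ : ℝ≥0
  Lζ_pos : 0 < Lζ
  lipschitz : LipschitzWith Lζ⁻¹ ζ
  monotone : Monotone ζ
  map_zero : ζ 0 = 0
  coercive : ∃ c > 0, ∃ b > 0, ∀ s, c * |s| - b ≤ |ζ s|
  Λ : Space d → Matrix (Fin d) (Fin d) ℝ
  Λ_meas : ∀ i j, AEMeasurable (fun x => Λ x i j) (volume.restrict Θ)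
  Λ_symm : ∀ᵐ x ∂(volume.restrict Θ), (Λ x).IsSymm
  Λ_elliptic : ∃ lo > 0, ∃ hi > 0, ∀ᵐ x ∂(volume.restrict Θ), ∀ ξ : Space d,
    lo * ‖ξ‖ ^ 2 ≤ ∑ i, ∑ j, Λ x i j * ξ j * ξ i ∧
      ∑ i, ∑ j, Λ x i j * ξ j * ξ i ≤ hi * ‖ξ‖ ^ 2
  u0 : Space d → ℝ
  u0_meas : AEMeasurable u0 (volume.restrict Θ)
  u0_Xi : Integrable (fun x => Xi ζ (u0 x)) (volume.restrict Θ)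

/-- Coercivity of `ζ` makes `Ξ` grow at least quadratically. -/
theorem sq_le_Xi {ζ : ℝ → ℝ} (hcont : Continuous ζ) (hmono : Monotone ζ) (h0 : ζ 0 = 0)
    {c b : ℝ} (hc : 0 < c) (hcoer : ∀ s, c * |s| - b ≤ |ζ s|) (s : ℝ) :
    s ^ 2 ≤ (4 / c) * Xi ζ s + 4 * b ^ 2 / c ^ 2 := by
  have key : c * s ^ 2 / 2 - b * |s| ≤ Xi ζ s := by
    have hi : ∀ x y : ℝ, IntervalIntegrable ζ volume x y := fun x y =>
      hcont.intervalIntegrable x y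
    rcases le_total 0 s with hs | hs
    · have h1 : ∫ t in (0 : ℝ)..s, (c * t - b) ≤ ∫ t in (0 : ℝ)..s, ζ t := by
        refine intervalIntegral.integral_mono_on hs
          (Continuous.intervalIntegrable (by fun_prop) _ _) (hi _ _) ?_
        intro t ht
        have hz : 0 ≤ ζ t := h0 ▸ hmono ht.1
        have := hcoer t
        rwa [abs_of_nonneg ht.1, abs_of_nonneg hz] at this
      have h2 : ∫ t in (0 : ℝ)..s, (c * t - b) = c * s ^ 2 / 2 - b * s := by
        rw [intervalIntegral.integral_sub (Continuous.intervalIntegrable (by fun_prop) _ _)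
          (Continuous.intervalIntegrable (by fun_prop) _ _)]
        rw [intervalIntegral.integral_const_mul, integral_id, intervalIntegral.integral_const,
          smul_eq_mul]
        ring
      rw [h2] at h1
      rw [abs_of_nonneg hs]
      exact h1
    · have h1 : ∫ t in s..(0 : ℝ), ζ t ≤ ∫ t in s..(0 : ℝ), (c * t + b) := by
        refine intervalIntegral.integral_mono_on hs (hi _ _)
          (Continuous.intervalIntegrable (by fun_prop) _ _) ?_
        intro t ht
        have hz : ζ t ≤ 0 := h0 ▸ hmono ht.2
        have := hcoer t
        rw [abs_of_nonpos ht.2, abs_of_nonpos hz] at this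
        linarith
      have h2 : ∫ t in s..(0 : ℝ), (c * t + b) = -(c * s ^ 2 / 2) - b * s := by
        rw [intervalIntegral.integral_add (Continuous.intervalIntegrable (by fun_prop) _ _)
          (Continuous.intervalIntegrable (by fun_prop) _ _)]
        rw [intervalIntegral.integral_const_mul, integral_id, intervalIntegral.integral_const,
          smul_eq_mul]
        ring
      rw [h2] at h1
      rw [abs_of_nonpos hs, Xi, intervalIntegral.integral_symm]
      linarith
  have h3 : c * s ^ 2 / 4 - b ^ 2 / c ≤ c * s ^ 2 / 2 - b * |s| := by
    have h4 : 0 ≤ (c * |s| / 2 - b) ^ 2 / c := by positivity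
    have h5 : (c * |s| / 2 - b) ^ 2 / c = c * s ^ 2 / 4 - b * |s| + b ^ 2 / c := by
      field_simp
      rw [← sq_abs s]
      ring
    linarith
  have h6 : c * s ^ 2 / 4 - b ^ 2 / c ≤ Xi ζ s := h3.trans key
  have h7 : s ^ 2 = (4 / c) * (c * s ^ 2 / 4 - b ^ 2 / c) + 4 * b ^ 2 / c ^ 2 := by
    field_simp
    ring
  rw [h7]
  have h8 : 0 < 4 / c := by positivity
  gcongr

namespace StefanData

variable {d : ℕ} (S : StefanData d)

/-- Lebesgue measure on `Θ`. -/
abbrev μ : Measure (Space d) := volume.restrict S.Θ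

/-- `L²(Θ)`. -/
abbrev L2 : Type := Lp ℝ 2 S.μ

/-- `L²(Θ)^d`. -/
abbrev L2d : Type := Lp (Space d) 2 S.μ

instance : IsFiniteMeasure S.μ := ⟨by
  rw [Measure.restrict_apply_univ]
  exact S.bounded.measure_lt_top⟩

theorem memLp_u0 : MemLp S.u0 2 S.μ := by
  obtain ⟨c, hc, b, -, hcoer⟩ := S.coercive
  rw [memLp_two_iff_integrable_sq S.u0_meas.aestronglyMeasurable]
  refine Integrable.mono' ((S.u0_Xi.const_mul (4 / c)).add (integrable_const (4 * b ^ 2 / c ^ 2)))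
    (S.u0_meas.pow_const 2).aestronglyMeasurable (ae_of_all _ fun x => ?_)
  rw [Real.norm_of_nonneg (sq_nonneg _)]
  exact sq_le_Xi S.lipschitz.continuous S.monotone S.map_zero hc hcoer (S.u0 x)

/-- The initial condition as an element of `L²(Θ)`. -/
def u0L2 : S.L2 := S.memLp_u0.toLp S.u0

/-- The superposition operator `w ↦ ζ(w)` on `L²(Θ)`. -/
def ζL2 (w : S.L2) : S.L2 := S.lipschitz.compLp S.map_zero w

/-- `⟨Λ F, G⟩ = ∫_Θ Λ(x) F(x) · G(x) dx`. -/
def lamInner (F G : S.L2d) : ℝ := ∫ x, ∑ i, ∑ j, S.Λ x i j * F x j * G x i ∂S.μ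

/-- `‖F‖_Λ = ⟨Λ F, F⟩^{1/2}`. -/
def lamNorm (F : S.L2d) : ℝ := √(S.lamInner F F)

/-- Smooth functions with compact support in `Θ`. -/
def IsTest (ψ : Space d → ℝ) : Prop :=
  ContDiff ℝ ((⊤ : ℕ∞) : WithTop ℕ∞) ψ ∧ HasCompactSupport ψ ∧ tsupport ψ ⊆ S.Θ

/-- The graph of the weak gradient on `H¹₀(Θ)`: the set of pairs `(φ, ∇φ)`, `φ ∈ H¹₀(Θ)`, i.e. the
closure in `L²(Θ) × L²(Θ)^d` of `{(ψ, ∇ψ) : ψ ∈ C_c^∞(Θ)}`. -/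
def H10 : Set (S.L2 × S.L2d) :=
  closure {p | ∃ ψ : Space d → ℝ, S.IsTest ψ ∧ p.1 =ᵐ[S.μ] ψ ∧ p.2 =ᵐ[S.μ] gradient ψ}

/-- The pairs `(φ, div φ)`, `φ ∈ H^div(Θ)`, the divergence being taken in the weak sense. -/
def Hdiv : Set (S.L2d × S.L2) :=
  {p | ∀ ψ : Space d → ℝ, S.IsTest ψ →
    ∫ x, ⟪p.1 x, gradient ψ x⟫ ∂S.μ = -∫ x, p.2 x * ψ x ∂S.μ}

/-- `Y = {v ∈ L²(Θ) : ζ(v) ∈ H¹₀(Θ)}`. -/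
def Y : Set S.L2 := {v | ∃ G, (S.ζL2 v, G) ∈ S.H10}

end StefanData

/-! ### Noise -/

section Noise

variable {κ K : Type*} [NormedAddCommGroup K] [InnerProductSpace ℝ K]

/-- The squared Hilbert–Schmidt norm `∑ₖ ‖A eₖ‖²` (it does not depend on the orthonormal basis). -/
def hsNormSq {H : Type*} [NormedAddCommGroup H] [InnerProductSpace ℝ H]
    (e : HilbertBasis κ ℝ K) (A : K →L[ℝ] H) : ℝ≥0∞ := ∑' k, ‖A (e k)‖ₑ ^ 2

/-- The noise coefficient `f : L²(Θ) → 𝓛(K, L²(Θ))`, with values in the Hilbert–Schmidt operators,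
continuous for the Hilbert–Schmidt norm, and with the growth
`‖f(ζ(w))‖² ≤ C₂ ∫_Θ Ξ(w) + C₁`. -/
structure NoiseCoeff {d : ℕ} (S : StefanData d) (e : HilbertBasis κ ℝ K) where
  f : S.L2 → K →L[ℝ] S.L2
  hilbertSchmidt : ∀ w, hsNormSq e (f w) < ∞
  continuous : ∀ w, Tendsto (fun v => hsNormSq e (f v - f w)) (𝓝 w) (𝓝 0)
  growth : ∃ C₁ > 0, ∃ C₂ > 0, ∀ w : S.L2, Integrable (fun x => Xi S.ζ (w x)) S.μ →
    hsNormSq e (f (S.ζL2 w)) ≤ ENNReal.ofReal (C₂ * ∫ x, Xi S.ζ (w x) ∂S.μ + C₁)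

variable {Ω : Type*} {mΩ : MeasurableSpace Ω}

/-- A real-valued standard Wiener process on `[0,T]`. -/
structure IsWiener {T : ℝ} (hT : 0 ≤ T) (X : Set.Icc (0 : ℝ) T → Ω → ℝ) (P : Measure Ω) :
    Prop where
  zero : ∀ᵐ ω ∂P, X ⟨0, le_rfl, hT⟩ ω = 0
  indepIncrements : HasIndepIncrements X P
  gaussian : ∀ s t, s ≤ t →
    HasLaw (fun ω => X t ω - X s ω) (gaussianReal 0 (Real.toNNReal (t - s : ℝ))) P
  continuous : ∀ᵐ ω ∂P, Continuous fun t => X t ω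

/-- `W(t) = ∑ₖ qₖ Wₖ(t) eₖ` is an `𝔽`-adapted `K`-valued Wiener process on `[0,T]`, whose covariance
operator `Q` is given by `Q eₖ = qₖ² eₖ`. -/
structure IsQWiener [MeasurableSpace K] {T : ℝ} (hT : 0 ≤ T) (e : HilbertBasis κ ℝ K) (q : κ → ℝ)
    (P : Measure Ω) (𝔽 : Filtration (Set.Icc (0 : ℝ) T) mΩ) (W : Set.Icc (0 : ℝ) T → Ω → K) :
    Prop where
  adapted : ∀ t, Measurable[𝔽 t] (W t)
  continuous : ∀ᵐ ω ∂P, Continuous fun t => W t ω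
  expansion : ∃ Wk : κ → Set.Icc (0 : ℝ) T → Ω → ℝ,
    (∀ k t, Measurable[𝔽 t] (Wk k t)) ∧ (∀ k, IsWiener hT (Wk k) P) ∧
    iIndepFun (fun k ω t => Wk k t ω) P ∧
    ∀ t, ∀ᵐ ω ∂P, HasSum (fun k => (q k * Wk k t ω) • e k) (W t ω)

end Noise

/-! ### Gradient discretisations -/

/-- A space-time gradient discretisation with piecewise constant reconstruction. The space of
unknowns is identified with `ℝ^ι` through its basis `(e_i)_{i ∈ ι}`; `cell i` is the set `Θ_i`;
`grad` is `∇_D` (the third condition says that `‖∇_D ·‖` is a norm); the interpolation operator is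
defined on a set `𝒴` of functions of `L²(Θ)`; the uniform time grid is `t^n = n T / N`. -/
structure GradDisc {d : ℕ} (S : StefanData d) (𝒴 : Set S.L2) where
  ι : Type
  [fintype : Fintype ι]
  cell : ι → Set (Space d)
  cell_meas : ∀ i, MeasurableSet (cell i)
  cell_subset : ∀ i, cell i ⊆ S.Θ
  cell_disjoint : Pairwise fun i j => Disjoint (cell i) (cell j)
  grad : (ι → ℝ) →ₗ[ℝ] S.L2d
  grad_norm : ∀ v, ‖grad v‖ = 0 → v = 0
  interp : 𝒴 → ι → ℝ
  N : ℕ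
  N_pos : 0 < N

attribute [instance] GradDisc.fintype

namespace GradDisc

variable {d : ℕ} {S : StefanData d} {𝒴 : Set S.L2} (D : GradDisc S 𝒴)

/-- The space of discrete unknowns `X_D`. -/
abbrev X : Type := D.ι → ℝ

/-- `g(v) = ∑ g(v_i) e_i`, used for `g = ζ`. -/
def ζX (v : D.X) : D.X := fun i => S.ζ (v i)

/-- `Π_D v = ∑ v_i 1_{Θ_i}` as a function on `ℝ^d`, equal to `0` outside `Θ`. -/
def reconFun (v : D.X) (x : Space d) : ℝ := ∑ i, (D.cell i).indicator (fun _ => v i) x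

theorem memLp_reconFun (v : D.X) : MemLp (D.reconFun v) 2 S.μ := by
  have h : ∀ i ∈ (Finset.univ : Finset D.ι),
      MemLp ((D.cell i).indicator (fun _ => v i)) 2 S.μ := fun i _ =>
    memLp_indicator_const 2 (D.cell_meas i) (v i) (Or.inr (measure_ne_top _ _))
  exact memLp_finsetSum _ h

/-- `Π_D v` as an element of `L²(Θ)`. -/
def recon (v : D.X) : S.L2 := (D.memLp_reconFun v).toLp (D.reconFun v)

/-- The time step `δt_D`. -/
def dt : ℝ := S.T / D.N

/-- The time `t^n` of the grid. -/
def time (n : Fin (D.N + 1)) : Set.Icc (0 : ℝ) S.T :=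
  ⟨n * (S.T / D.N), by
    have hT := S.T_pos.le
    positivity, by
    have hN : (0 : ℝ) < D.N := by exact_mod_cast D.N_pos
    have hn : ((n : ℕ) : ℝ) ≤ D.N := by exact_mod_cast Nat.lt_succ_iff.mp n.2
    calc ((n : ℕ) : ℝ) * (S.T / D.N) ≤ D.N * (S.T / D.N) := by
          have := S.T_pos.le
          gcongr
      _ = S.T := by field_simp⟩

/-- The index `n` attached to a time `t`: `0` at `t = 0` and `n + 1` if `t ∈ (t^n, t^{n+1}]`. -/
def idx (t : ℝ) : Fin (D.N + 1) := ⟨min ⌈t / D.dt⌉₊ D.N, by omega⟩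

/-- The piecewise constant in time function `Π_D v : [0,T] → L²(Θ)`. -/
def reconT (v : Fin (D.N + 1) → D.X) (t : ℝ) : S.L2 := D.recon (v (D.idx t))

/-- The piecewise constant in time function `∇_D v : (0,T] → L²(Θ)^d`. -/
def gradT (v : Fin (D.N + 1) → D.X) (t : ℝ) : S.L2d := D.grad (v (D.idx t))

/-- `‖Π_D v‖_{L^∞(0,T; L²(Θ))}`. -/
def normLinfL2 (v : Fin (D.N + 1) → D.X) : ℝ≥0∞ :=
  eLpNorm (fun t => D.reconT v t) ∞ (volume.restrict (Set.Ioo 0 S.T))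

/-- `‖∇_D v‖_{L²(Θ_T)}`, with `Θ_T = (0,T) × Θ`. -/
def normGradL2 (v : Fin (D.N + 1) → D.X) : ℝ≥0∞ :=
  eLpNorm (fun p : ℝ × Space d => D.gradT v p.1 p.2) 2
    ((volume.restrict (Set.Ioo 0 S.T)).prod S.μ)

/-- `∫_Θ Ξ(Π_D v)` (the integrand is nonnegative). -/
def XiInt (v : D.X) : ℝ≥0∞ := ∫⁻ x, ENNReal.ofReal (Xi S.ζ (D.recon v x)) ∂S.μ

/-! ### Properties of sequences of gradient discretisations -/

/-- `S_D(φ)` for `φ ∈ H¹₀(Θ)` with gradient `G`. -/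
def consistencyDefect (φ : S.L2) (G : S.L2d) : ℝ :=
  ⨅ w : D.X, (‖D.recon w - φ‖ + ‖D.grad w - G‖)

/-- `W_D(φ)` for `φ ∈ H^div(Θ)` with divergence `g`. -/
def conformityDefect (φ : S.L2d) (g : S.L2) : ℝ :=
  ⨆ v : {v : D.X // v ≠ 0}, |⟪D.grad v, φ⟫ + ⟪D.recon v, g⟫| / ‖D.grad v‖

/-- `T_D(ξ)`. -/
def translateDefect (ξ : Space d) : ℝ≥0∞ :=
  ⨆ v : {v : D.X // v ≠ 0},
    eLpNorm (fun x => D.reconFun v (x + ξ) - D.reconFun v x) 2 volume / ‖D.grad v‖ₑ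

end GradDisc

section Sequences

variable {d : ℕ} {S : StefanData d} {𝒴 : Set S.L2}

/-- Consistency of a sequence of gradient discretisations. -/
structure Consistent (D : ℕ → GradDisc S 𝒴) : Prop where
  space : ∀ φ G, (φ, G) ∈ S.H10 →
    Tendsto (fun m => (D m).consistencyDefect φ G) atTop (𝓝 0)
  interp : ∀ φ : 𝒴, Tendsto (fun m => (D m).recon ((D m).interp φ)) atTop (𝓝 (φ : S.L2))
  interp_grad : ∀ φ : 𝒴, ∃ M : ℝ, ∀ m,
    (D m).dt * S.lamNorm ((D m).grad ((D m).ζX ((D m).interp φ))) ≤ M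
  time : Tendsto (fun m => (D m).dt) atTop (𝓝 0)

/-- Limit-conformity of a sequence of gradient discretisations. -/
def LimitConforming (D : ℕ → GradDisc S 𝒴) : Prop :=
  ∀ φ g, (φ, g) ∈ S.Hdiv → Tendsto (fun m => (D m).conformityDefect φ g) atTop (𝓝 0)

/-- Compactness of a sequence of gradient discretisations. -/
def CompactSeq (D : ℕ → GradDisc S 𝒴) : Prop :=
  Tendsto (fun ξ => ⨆ m, (D m).translateDefect ξ) (𝓝 0) (𝓝 0)

end Sequences

/-! ### The gradient scheme -/

section Scheme

variable {d : ℕ} {S : StefanData d} {𝒴 : Set S.L2} (D : GradDisc S 𝒴)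
  {κ K : Type*} [NormedAddCommGroup K] [InnerProductSpace ℝ K] [MeasurableSpace K]
  {Ω : Type*}

/-- The σ-algebra generated by `W(t^0), …, W(t^n)`. -/
abbrev GradDisc.gridSigma (W : Set.Icc (0 : ℝ) S.T → Ω → K) (n : Fin (D.N + 1)) :
    MeasurableSpace Ω :=
  ⨆ k : Fin (D.N + 1), ⨆ _ : k ≤ n, MeasurableSpace.comap (W (D.time k)) inferInstance

/-- `u = (u^{(n)})_{0 ≤ n ≤ N}` is a solution of the gradient scheme. -/
structure IsSolution {e : HilbertBasis κ ℝ K} (F : NoiseCoeff S e) (hu0 : S.u0L2 ∈ 𝒴)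
    [MeasurableSpace Ω] (P : Measure Ω) (W : Set.Icc (0 : ℝ) S.T → Ω → K)
    (u : Fin (D.N + 1) → Ω → D.X) : Prop where
  initial : ∀ ω, u 0 ω = D.interp ⟨S.u0L2, hu0⟩
  adapted : ∀ n, Measurable[D.gridSigma W n] (u n)
  scheme : ∀ φ : D.X, ∀ᵐ ω ∂P, ∀ n : Fin D.N,
    ⟪D.recon (u n.succ ω) - D.recon (u n.castSucc ω), D.recon φ⟫
      + D.dt * S.lamInner (D.grad (D.ζX (u n.succ ω))) (D.grad φ)
      = ⟪F.f (D.recon (D.ζX (u n.castSucc ω)))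
          (W (D.time n.succ) ω - W (D.time n.castSucc) ω), D.recon φ⟫

end Scheme

end StochStefan

end

noncomputable section

namespace StochStefan

/-! ### Expansions in a Hilbert basis and a weighted Cauchy–Schwarz inequality. -/

section NoiseLemmas

variable {κ K : Type*} [NormedAddCommGroup K] [InnerProductSpace ℝ K]

/-! Write `E n` for the energy `∫ Ξ(Π u^(n))`. Because the cells are disjoint and `ζ 0 = 0`, `Π`
commutes with `ζ`, so testing the scheme with `ζ(u^(n+1))` produces `⟪Π u^(n+1) - Π u^(n), ζ(Π
u^(n+1))⟫`. Since `Ξ' = ζ` is monotone and Lipschitz, this dominates `E (n+1) - E n + (Lζ/2) ‖Δζ‖²`,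
with `Δζ = ζ(Π u^(n+1)) - ζ(Π u^(n))` (`Xi_bregman`). In the noise term, `ζ(u^(n+1))` is replaced by
`ζ(u^(n))`, and Young's inequality absorbs the error into the quadratic gain. Thus `E (n+1) + G n ≤
E n + ξ n + η n`, where `G n` is the dissipation, `ξ n` a martingale increment of size `(E n + 1)
‖ΔW‖`, and `η n = ‖f ΔW‖² / (2 Lζ)` has size `(E n + 1) ‖ΔW‖²` (`energyBalance`).

The rest is probabilistic. Summation bounds the energy and the accumulated dissipation by `Z n = A +
max |∑ ξ| + ∑ η`. Square this and take expectations: a pathwise Doob inequality (`sq_absMax_le`)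
handles the martingale, and Cauchy–Schwarz the sum of the `η`. As `ΔW` is independent of the past
and has fourth moment of order `δt²`, both contributions are at most a constant times `δt ∑ 𝔼 (E i +
1)²`; the factor `n` lost in Cauchy–Schwarz is paid for by the second power of `δt`. Discrete
Gronwall bounds `𝔼 (Z N)²` uniformly in `N` (`integral_sq_bound_le_exp`).

Both estimates follow from this bound: the energies and the `lo`-weighted dissipation are at most `Z
N`, and coercivity of `ζ` gives `‖Π u^(n)‖² ≤ b (E n + 1)`, which controls the fourth and hence all
lower moments. -/

theorem separableSpace_of_hilbertBasis [Countable κ] (e : HilbertBasis κ ℝ K) :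
    TopologicalSpace.SeparableSpace K := by
  have h := (Set.countable_range e).isSeparable.span (R := ℝ) |>.closure
  rw [← Submodule.topologicalClosure_coe, e.dense_span] at h
  exact TopologicalSpace.isSeparable_univ_iff.1 h

theorem secondCountable_of_hilbertBasis [Countable κ] (e : HilbertBasis κ ℝ K) :
    SecondCountableTopology K :=
  have := separableSpace_of_hilbertBasis e
  UniformSpace.secondCountable_of_separable K

theorem hasSum_inner_smul_hilbertBasis (e : HilbertBasis κ ℝ K) (x : K) :
    HasSum (fun k => ⟪e k, x⟫ • e k) x := by
  simpa only [HilbertBasis.repr_apply_apply] using e.hasSum_repr x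

theorem inner_hilbertBasis_of_hasSum (e : HilbertBasis κ ℝ K) {a : κ → ℝ} {x : K}
    (h : HasSum (fun k => a k • e k) x) (k : κ) : ⟪e k, x⟫ = a k := by
  classical
  have h1 : HasSum (fun j => ⟪e k, a j • e j⟫) ⟪e k, x⟫ := h.mapL (innerSL ℝ (e k))
  have h2 : ∀ j, j ≠ k → ⟪e k, a j • e j⟫ = 0 := fun j hj => by
    rw [inner_smul_right, e.orthonormal.inner_eq_zero hj.symm, mul_zero]
  have h3 := h1.unique (hasSum_single k h2)
  rw [h3, inner_smul_right, real_inner_self_eq_norm_sq, e.orthonormal.1 k]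
  simp

theorem hasSum_sq_inner_hilbertBasis (e : HilbertBasis κ ℝ K) (x : K) :
    HasSum (fun k => ⟪e k, x⟫ ^ 2) (‖x‖ ^ 2) := by
  have h := e.hasSum_inner_mul_inner x x
  rw [real_inner_self_eq_norm_sq] at h
  refine h.congr_fun fun k => ?_
  rw [real_inner_comm, sq]

/-- The vector is the pointwise limit of its finite partial expansions. This reduces questions about
the σ-algebra of `W` to the scalar coordinates. -/
theorem measurable_of_coordinates [Countable κ] [MeasurableSpace K] [BorelSpace K] {α : Type*}
    {m : MeasurableSpace α} (e : HilbertBasis κ ℝ K) {V : α → K}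
    (h : ∀ k, Measurable fun a => ⟪e k, V a⟫) : Measurable V := by
  refine measurable_of_tendsto_metrizable' (atTop : Filter (Finset κ))
    (f := fun s a => ∑ k ∈ s, ⟪e k, V a⟫ • e k) (fun s => ?_) ?_
  · have := secondCountable_of_hilbertBasis e
    exact Finset.measurable_fun_sum _ fun k _ => (h k).smul_const _
  · rw [tendsto_pi_nhds]
    exact fun a => hasSum_inner_smul_hilbertBasis e (V a)

/-- Expand the square as a double sum and use `2 b_k b_l ≤ b_k² + b_l²`; working in `ℝ≥0∞` avoids
any summability condition. With `a_k = q_k²` it passes from `‖ΔW‖⁴` to the fourth powers of the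
scalar increments. -/
theorem ennreal_sq_tsum_mul_le (a b : κ → ℝ≥0∞) :
    (∑' k, a k * b k) ^ 2 ≤ (∑' k, a k) * ∑' k, a k * b k ^ 2 := by
  have h : ∀ k l, 2 * (b k * b l) ≤ b k ^ 2 + b l ^ 2 := by
    intro k l
    induction hk : b k with
    | top => simp
    | coe x =>
      induction hl : b l with
      | top => simp
      | coe y =>
        norm_cast
        rw [← mul_assoc]
        exact two_mul_le_add_sq x y
  have h1 : 2 * (∑' k, a k * b k) ^ 2 ≤ 2 * ((∑' k, a k) * ∑' k, a k * b k ^ 2) := by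
    calc 2 * (∑' k, a k * b k) ^ 2 = ∑' k, ∑' l, a k * a l * (2 * (b k * b l)) := by
          rw [sq, ← ENNReal.tsum_mul_right, ← ENNReal.tsum_mul_left]
          refine tsum_congr fun k => ?_
          rw [← ENNReal.tsum_mul_left, ← ENNReal.tsum_mul_left]
          refine tsum_congr fun l => ?_
          ring
      _ ≤ ∑' k, ∑' l, (a l * (a k * b k ^ 2) + a k * (a l * b l ^ 2)) := by
          refine ENNReal.tsum_le_tsum fun k => ENNReal.tsum_le_tsum fun l => ?_
          calc _ ≤ a k * a l * (b k ^ 2 + b l ^ 2) := by gcongr; exact h k l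
            _ = _ := by ring
      _ = 2 * ((∑' k, a k) * ∑' k, a k * b k ^ 2) := by
          simp_rw [ENNReal.tsum_add, ENNReal.tsum_mul_left, ENNReal.tsum_mul_right,
            ENNReal.tsum_mul_left]
          ring
  rwa [ENNReal.mul_le_mul_iff_right (by simp) (by simp)] at h1

end NoiseLemmas

/-! ### Increments of the Wiener process: moments and independence. -/

section Wiener

variable {Ω : Type*} {mΩ : MeasurableSpace Ω} {P : Measure Ω}

/-- The fourth moment of the standard Gaussian law. -/
def gaussFour : ℝ≥0∞ := ∫⁻ x, ‖x‖ₑ ^ 4 ∂(gaussianReal 0 1)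

theorem gaussFour_lt_top : gaussFour < ∞ := by
  have h := (memLp_id_gaussianReal (μ := 0) (v := 1) 4).eLpNorm_lt_top
  have := lintegral_rpow_enorm_lt_top_of_eLpNorm_lt_top (p := 4) (by simp) (by simp) h
  simpa [gaussFour] using this

/-- By scaling: the law is the image of the standard Gaussian under multiplication by `√v`. -/
theorem lintegral_enorm_gaussian_four {X : Ω → ℝ} {v : ℝ≥0} (h : HasLaw X (gaussianReal 0 v) P) :
    ∫⁻ ω, ‖X ω‖ₑ ^ 4 ∂P = (v : ℝ≥0∞) ^ 2 * gaussFour := by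
  have h2 : gaussianReal 0 v = (gaussianReal 0 1).map (fun x => √(v : ℝ) * x) := by
    rw [gaussianReal_map_const_mul]
    congr 1
    · simp
    · ext; simp
  rw [h.lintegral_comp (f := fun x => ‖x‖ₑ ^ 4) (by fun_prop), h2,
    lintegral_map (by fun_prop) (by fun_prop), gaussFour, ← lintegral_const_mul _ (by fun_prop)]
  refine lintegral_congr fun x => ?_
  rw [enorm_mul, mul_pow]
  congr 1
  have h3 : √(v : ℝ) ^ 4 = (v : ℝ) ^ 2 := by
    rw [show (4 : ℕ) = 2 * 2 from rfl, pow_mul, Real.sq_sqrt (NNReal.coe_nonneg v)]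
  rw [Real.enorm_of_nonneg (Real.sqrt_nonneg _), ← ENNReal.ofReal_pow (Real.sqrt_nonneg _), h3,
    ENNReal.ofReal_pow (NNReal.coe_nonneg v), ENNReal.ofReal_coe_nnreal]

variable {κ K : Type*} [NormedAddCommGroup K] [InnerProductSpace ℝ K]
  [MeasurableSpace K] {T : ℝ} {hT : 0 ≤ T} {e : HilbertBasis κ ℝ K} {q : κ → ℝ}
  {𝔽 : Filtration (Set.Icc (0 : ℝ) T) mΩ} {W : Set.Icc (0 : ℝ) T → Ω → K}

theorem IsQWiener.measurable (hW : IsQWiener hT e q P 𝔽 W) (t) : Measurable (W t) :=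
  (hW.adapted t).mono (𝔽.le t) le_rfl

/-- The increment of `W` over `[τ n, τ (n + 1)]` is independent of `W (τ 0), …, W (τ n)`. -/
theorem IsQWiener.indep_increment [Countable κ] [BorelSpace K]
    (hW : IsQWiener hT e q P 𝔽 W) {τ : ℕ → Set.Icc (0 : ℝ) T}
    (hτ : Monotone τ) (hτ0 : τ 0 = ⟨0, le_rfl, hT⟩) (n : ℕ) :
    Indep (⨆ j : Fin (n + 1), MeasurableSpace.comap (W (τ j)) inferInstance)
      (MeasurableSpace.comap (fun ω => W (τ (n + 1)) ω - W (τ n) ω) inferInstance) P := by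
  obtain ⟨X, hXm, hX, hXi, hXW⟩ := hW.expansion
  have hXm' : ∀ k t, Measurable (X k t) := fun k t => (hXm k t).mono (𝔽.le t) le_rfl
  set D : κ → ℕ → Ω → ℝ := fun k j ω => X k (τ (j + 1)) ω - X k (τ j) ω with hD
  have hDm : ∀ k j, Measurable (D k j) := fun k j => (hXm' k _).sub (hXm' k _)
  -- Independence across the components, together with independent increments within each one, gives
  -- joint independence over both indices. Past and future then correspond to disjoint index sets.
  have hDind : iIndepFun (fun (p : κ × ℕ) ω => D p.1 p.2 ω) P := by
    refine iIndepFun_uncurry' hDm ?_ fun k => (hX k).indepIncrements.nat hτ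
    exact hXi.comp (fun _ x j => x (τ (j + 1)) - x (τ j)) fun _ => by fun_prop
  have hsplit := indep_iSup_of_disjoint (fun p : κ × ℕ => (hDm p.1 p.2).comap_le) hDind.iIndep
    (S := {p | p.2 < n}) (T := {p | p.2 = n})
    (Set.disjoint_left.2 fun p hp hp' => (ne_of_lt hp) hp')
  set past : Ω → Fin (n + 1) × κ → ℝ := fun ω p => ⟪e p.2, W (τ p.1) ω⟫ with hpast
  -- The coordinates of `W` agree with `q k * X k` only almost surely. Independence is therefore
  -- proved for copies built from the scalar increments (telescoping from `X k 0 = 0`) and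
  -- transferred by almost sure equality; countability of `κ` keeps the exceptional set null.
  set past' : Ω → Fin (n + 1) × κ → ℝ := fun ω p => q p.2 * ∑ j ∈ Finset.range p.1, D p.2 j ω
    with hpast'
  set incr : Ω → κ → ℝ := fun ω k => ⟪e k, W (τ (n + 1)) ω - W (τ n) ω⟫ with hincr
  set incr' : Ω → κ → ℝ := fun ω k => q k * D k n ω with hincr'
  have hcoord : ∀ t, ∀ᵐ ω ∂P, ∀ k, ⟪e k, W t ω⟫ = q k * X k t ω := fun t => by
    filter_upwards [hXW t] with ω hω k
    exact inner_hilbertBasis_of_hasSum e hω k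
  have hpp : past' =ᵐ[P] past := by
    filter_upwards [ae_all_iff.2 fun j => hcoord (τ j), ae_all_iff.2 fun k => (hX k).zero]
      with ω h1 h2
    funext p
    simp only [hpast, hpast', hD]
    rw [h1, Finset.sum_range_sub (fun j => X p.2 (τ j) ω), hτ0, h2, sub_zero]
  have hii : incr' =ᵐ[P] incr := by
    filter_upwards [hcoord (τ (n + 1)), hcoord (τ n)] with ω h1 h2
    funext k
    simp only [hincr, hincr', hD]
    rw [inner_sub_right, h1, h2, mul_sub]
  have hind : IndepFun past' incr' P := by
    refine indep_of_indep_of_le hsplit ?_ ?_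
    · rw [← measurable_iff_comap_le]
      refine @measurable_pi_lambda _ _ _ (_) _ _ fun p => ?_
      refine Measurable.const_mul (@Finset.measurable_fun_sum _ _ _ _ _ _ (_) _ _ fun j hj => ?_) _
      refine Measurable.mono (comap_measurable (D p.2 j)) ?_ le_rfl
      refine le_iSup₂_of_le (p.2, j) ?_ le_rfl
      have := Finset.mem_range.1 hj
      have := p.1.2
      simp only [Set.mem_ofPred_eq]
      omega
    · rw [← measurable_iff_comap_le]
      refine @measurable_pi_lambda _ _ _ (_) _ _ fun k => ?_
      refine Measurable.const_mul ?_ _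
      exact Measurable.mono (comap_measurable (D k n)) (le_iSup₂_of_le (k, n) rfl le_rfl) le_rfl
  refine indep_of_indep_of_le (hind.congr hpp hii) ?_ ?_
  · refine iSup_le fun j => ?_
    rw [← measurable_iff_comap_le]
    refine measurable_of_coordinates e fun k => ?_
    exact (measurable_pi_apply (j, k)).comp (comap_measurable past)
  · rw [← measurable_iff_comap_le]
    refine measurable_of_coordinates e fun k => ?_
    exact (measurable_pi_apply k).comp (comap_measurable incr)

theorem IsQWiener.lintegral_enorm_increment_four_le [Countable κ]
    (hW : IsQWiener hT e q P 𝔽 W)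
    {s t : Set.Icc (0 : ℝ) T} (hst : s ≤ t) :
    ∫⁻ ω, ‖W t ω - W s ω‖ₑ ^ 4 ∂P ≤
      (∑' k, ‖q k‖ₑ ^ 2) ^ 2 * (ENNReal.ofReal (t - s) ^ 2 * gaussFour) := by
  obtain ⟨X, hXm, hX, -, hXW⟩ := hW.expansion
  have hXm' : ∀ k t, Measurable (X k t) := fun k t => (hXm k t).mono (𝔽.le t) le_rfl
  have hpt : ∀ᵐ ω ∂P, ‖W t ω - W s ω‖ₑ ^ 4 ≤
      (∑' k, ‖q k‖ₑ ^ 2) * ∑' k, ‖q k‖ₑ ^ 2 * ‖X k t ω - X k s ω‖ₑ ^ 4 := by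
    filter_upwards [hXW t, hXW s] with ω h1 h2
    have h3 : ‖W t ω - W s ω‖ₑ ^ 2 = ∑' k, ‖q k‖ₑ ^ 2 * ‖X k t ω - X k s ω‖ₑ ^ 2 := by
      have h4 := hasSum_sq_inner_hilbertBasis e (W t ω - W s ω)
      have h5 : ∀ x : K, ‖x‖ₑ ^ 2 = ENNReal.ofReal (‖x‖ ^ 2) := fun x => by
        rw [ENNReal.ofReal_pow (norm_nonneg _), ofReal_norm]
      rw [h5, ← h4.tsum_eq, ENNReal.ofReal_tsum_of_nonneg (fun _ => sq_nonneg _) h4.summable]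
      refine tsum_congr fun k => ?_
      rw [inner_sub_right, inner_hilbertBasis_of_hasSum e h1, inner_hilbertBasis_of_hasSum e h2,
        ← mul_sub, ← mul_pow, ← enorm_mul, ← sq_abs, ENNReal.ofReal_pow (abs_nonneg _),
        Real.enorm_eq_ofReal_abs]
    calc ‖W t ω - W s ω‖ₑ ^ 4 = (‖W t ω - W s ω‖ₑ ^ 2) ^ 2 := by rw [← pow_mul]
      _ ≤ _ := by
        rw [h3]
        refine (ennreal_sq_tsum_mul_le _ _).trans_eq ?_
        simp_rw [← pow_mul]
  calc ∫⁻ ω, ‖W t ω - W s ω‖ₑ ^ 4 ∂P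
      ≤ ∫⁻ ω, (∑' k, ‖q k‖ₑ ^ 2) * ∑' k, ‖q k‖ₑ ^ 2 * ‖X k t ω - X k s ω‖ₑ ^ 4 ∂P :=
        lintegral_mono_ae hpt
    _ = (∑' k, ‖q k‖ₑ ^ 2) * ∑' k, ‖q k‖ₑ ^ 2 * (ENNReal.ofReal (t - s) ^ 2 * gaussFour) := by
        have hm : ∀ k, Measurable fun ω => ‖X k t ω - X k s ω‖ₑ ^ 4 := fun k =>
          ((hXm' k t).sub (hXm' k s)).enorm.pow_const 4
        rw [lintegral_const_mul _ (Measurable.tsum fun k => (hm k).const_mul _),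
          lintegral_tsum fun k => ((hm k).const_mul _).aemeasurable]
        congr 1
        refine tsum_congr fun k => ?_
        rw [lintegral_const_mul _ (hm k), lintegral_enorm_gaussian_four ((hX k).gaussian s t hst)]
        rfl
    _ = _ := by
        rw [ENNReal.tsum_mul_right]
        ring

/-- The constant is `(∑ q_k²)²` times the standard Gaussian fourth moment, so it can be fixed before
the stochastic basis. The order `(t - s)²` is what makes the later sums over time steps converge. -/
theorem IsQWiener.exists_fourth_moment [Countable κ] [BorelSpace K]
    (hT : 0 ≤ T) (e : HilbertBasis κ ℝ K) (q : κ → ℝ)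
    (hq : Summable fun k => q k ^ 2) :
    ∃ c : ℝ, 0 ≤ c ∧ ∀ (Ω : Type*) [mΩ : MeasurableSpace Ω] (P : Measure Ω)
      [IsProbabilityMeasure P] (𝔽 : Filtration (Set.Icc (0 : ℝ) T) mΩ)
      (W : Set.Icc (0 : ℝ) T → Ω → K), IsQWiener hT e q P 𝔽 W → ∀ s t, s ≤ t →
      Integrable (fun ω => ‖W t ω - W s ω‖ ^ 4) P ∧
        ∫ ω, ‖W t ω - W s ω‖ ^ 4 ∂P ≤ c * (t - s : ℝ) ^ 2 := by
  have hfin : (∑' k, ‖q k‖ₑ ^ 2) ^ 2 * gaussFour < ∞ := by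
    refine ENNReal.mul_lt_top (ENNReal.pow_lt_top ?_) gaussFour_lt_top
    have h : ∀ k, ‖q k‖ₑ ^ 2 = ENNReal.ofReal (q k ^ 2) := fun k => by
      rw [← sq_abs, ENNReal.ofReal_pow (abs_nonneg _), Real.enorm_eq_ofReal_abs]
    simp_rw [h]
    exact hq.tsum_ofReal_lt_top
  refine ⟨((∑' k, ‖q k‖ₑ ^ 2) ^ 2 * gaussFour).toReal, ENNReal.toReal_nonneg, ?_⟩
  intro Ω mΩ P _ 𝔽 W hW s t hst
  have := secondCountable_of_hilbertBasis e
  have hm : Measurable fun ω => ‖W t ω - W s ω‖ ^ 4 :=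
    ((hW.measurable t).sub (hW.measurable s)).norm.pow_const 4
  have hst' : (0 : ℝ) ≤ t - s := sub_nonneg.2 hst
  have hle : ∫⁻ ω, ENNReal.ofReal (‖W t ω - W s ω‖ ^ 4) ∂P ≤
      ENNReal.ofReal (((∑' k, ‖q k‖ₑ ^ 2) ^ 2 * gaussFour).toReal * (t - s : ℝ) ^ 2) := by
    rw [ENNReal.ofReal_mul ENNReal.toReal_nonneg, ENNReal.ofReal_toReal hfin.ne,
      ENNReal.ofReal_pow hst']
    have h := hW.lintegral_enorm_increment_four_le hst
    calc _ = ∫⁻ ω, ‖W t ω - W s ω‖ₑ ^ 4 ∂P := by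
          refine lintegral_congr fun ω => ?_
          rw [ENNReal.ofReal_pow (norm_nonneg _), ofReal_norm]
      _ ≤ _ := h
      _ = _ := by ring
  have h0 : 0 ≤ᵐ[P] fun ω => ‖W t ω - W s ω‖ ^ 4 := ae_of_all _ fun ω => by positivity
  refine ⟨⟨hm.aestronglyMeasurable, ?_⟩, ?_⟩
  · rw [hasFiniteIntegral_iff_ofReal h0]
    exact hle.trans_lt ENNReal.ofReal_lt_top
  · rw [integral_eq_lintegral_of_nonneg_ae h0 hm.aestronglyMeasurable]
    exact ENNReal.toReal_le_of_le_ofReal (by positivity) hle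

theorem IsQWiener.integral_increment [CompleteSpace K] (hW : IsQWiener hT e q P 𝔽 W)
    {s t : Set.Icc (0 : ℝ) T} (hst : s ≤ t) (hint : Integrable (fun ω => W t ω - W s ω) P) :
    ∫ ω, (W t ω - W s ω) ∂P = 0 := by
  obtain ⟨X, hXm, hX, -, hXW⟩ := hW.expansion
  have hk : ∀ k, ⟪e k, ∫ ω, (W t ω - W s ω) ∂P⟫ = 0 := fun k => by
    rw [← integral_inner hint]
    have h : ∀ᵐ ω ∂P, ⟪e k, W t ω - W s ω⟫ = q k * (X k t ω - X k s ω) := by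
      filter_upwards [hXW t, hXW s] with ω h1 h2
      rw [inner_sub_right, inner_hilbertBasis_of_hasSum e h1, inner_hilbertBasis_of_hasSum e h2,
        mul_sub]
    rw [integral_congr_ae h, integral_const_mul, ((hX k).gaussian s t hst).integral_eq,
      integral_id_gaussianReal, mul_zero]
  have h := hasSum_inner_smul_hilbertBasis e (∫ ω, (W t ω - W s ω) ∂P)
  simp only [hk, zero_smul] at h
  exact h.unique hasSum_zero

end Wiener

/-! ### Deterministic inequalities for sequences: Gronwall and Doob. -/

section Pathwise

/-- Discrete Gronwall inequality. -/
theorem discrete_gronwall {a b : ℝ} (hb : 0 ≤ b) {z : ℕ → ℝ} {N : ℕ}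
    (h : ∀ n ≤ N, z n ≤ a + b * ∑ i ∈ Finset.range n, z i) : ∀ n ≤ N, z n ≤ a * (1 + b) ^ n := by
  -- The induction is run on the right-hand side of the hypothesis, which grows at most by the
  -- factor `1 + b` per step; no sign condition on `a` or `z` is needed.
  have hs : ∀ n ≤ N, a + b * ∑ i ∈ Finset.range n, z i ≤ a * (1 + b) ^ n := by
    intro n
    induction n with
    | zero => simp
    | succ n ih =>
      intro hn
      have h1 := h n (by omega)
      have h2 := ih (by omega)
      rw [Finset.sum_range_succ, pow_succ]
      nlinarith [mul_le_mul_of_nonneg_left h1 hb, mul_le_mul_of_nonneg_left h2 hb]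
  exact fun n hn => (h n hn).trans (hs n hn)

/-- The sign of a real number, with the convention that `0` has sign `1`. -/
def sgn (x : ℝ) : ℝ := if 0 ≤ x then 1 else -1

theorem sgn_mul_self (x : ℝ) : sgn x * x = |x| := by
  unfold sgn
  split_ifs with h
  · rw [one_mul, abs_of_nonneg h]
  · rw [neg_one_mul, abs_of_neg (not_le.1 h)]

theorem abs_sgn (x : ℝ) : |sgn x| = 1 := by
  unfold sgn
  split_ifs <;> simp

theorem measurable_sgn : Measurable sgn :=
  Measurable.ite measurableSet_Ici measurable_const measurable_const

/-- The running maximum of `|x|`. -/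
def absMax (x : ℕ → ℝ) (n : ℕ) : ℝ := partialSups (fun i => |x i|) n

theorem absMax_succ (x : ℕ → ℝ) (n : ℕ) : absMax x (n + 1) = max (absMax x n) |x (n + 1)| :=
  partialSups_add_one _ n

theorem absMax_zero (x : ℕ → ℝ) : absMax x 0 = |x 0| := partialSups_zero _

theorem abs_le_absMax (x : ℕ → ℝ) (n : ℕ) : |x n| ≤ absMax x n :=
  le_partialSups (fun i => |x i|) n

theorem absMax_nonneg (x : ℕ → ℝ) (n : ℕ) : 0 ≤ absMax x n :=
  (abs_nonneg _).trans (abs_le_absMax x n)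

theorem absMax_mono (x : ℕ → ℝ) : Monotone (absMax x) := (partialSups _).monotone

/-- Pathwise form of Doob's quadratic maximal inequality. -/
theorem sq_absMax_le (x : ℕ → ℝ) (n : ℕ) :
    absMax x n ^ 2 ≤ 4 * x n ^ 2
      - 4 * ∑ i ∈ Finset.range n, absMax x i * sgn (x i) * (x (i + 1) - x i) := by
  -- Until `|x|` exceeds its running maximum only the last factor changes; when it does, the gain is
  -- a completed square. The claim then follows from `(absMax x n - 2 |x n|)² ≥ 0`.
  have key : ∑ i ∈ Finset.range n, absMax x i * sgn (x i) * (x (i + 1) - x i)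
      ≤ absMax x n * |x n| - absMax x n ^ 2 / 2 := by
    induction n with
    | zero =>
      rw [absMax_zero, Finset.sum_range_zero]
      nlinarith [sq_nonneg |x 0|]
    | succ n ih =>
      rw [Finset.sum_range_succ]
      have h0 := absMax_nonneg x n
      have h1 : absMax x n * sgn (x n) * (x (n + 1) - x n)
          ≤ absMax x n * (|x (n + 1)| - |x n|) := by
        rw [mul_assoc]
        refine mul_le_mul_of_nonneg_left ?_ h0
        rw [mul_sub, sgn_mul_self]
        have : sgn (x n) * x (n + 1) ≤ |x (n + 1)| := by
          refine (le_abs_self _).trans_eq ?_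
          rw [abs_mul, abs_sgn, one_mul]
        linarith
      rw [absMax_succ]
      rcases le_total |x (n + 1)| (absMax x n) with h | h
      · rw [max_eq_left h]
        linarith
      · rw [max_eq_right h]
        nlinarith [sq_nonneg (|x (n + 1)| - absMax x n)]
  nlinarith [sq_nonneg (absMax x n - 2 * |x n|), sq_abs (x n)]

end Pathwise

/-! ### Second moments in an abstract stochastic energy inequality. -/

variable {Ω : Type*} {mΩ : MeasurableSpace Ω}

/-- A stochastic discrete energy inequality `E (n + 1) + G n ≤ E n + ξ n + η n` for `n < N`, with
martingale increments `ξ` of size `(E + 1) w` and corrections `η` of size `(E + 1) w²`, where `w` is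
the size of an independent noise of standard deviation `√δ`. -/
structure EnergyBalance (P : Measure Ω) (N : ℕ) (A B c δ : ℝ) (𝓖 : ℕ → MeasurableSpace Ω)
    (E G ξ η w : ℕ → Ω → ℝ) : Prop where
  le : ∀ n, 𝓖 n ≤ mΩ
  mono : Monotone 𝓖
  E_meas : ∀ n, Measurable[𝓖 n] (E n)
  E_nonneg : ∀ n ω, 0 ≤ E n ω
  G_nonneg : ∀ n ω, 0 ≤ G n ω
  ξ_meas : ∀ n < N, Measurable[𝓖 (n + 1)] (ξ n)
  η_meas : ∀ n < N, Measurable (η n)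
  w_meas : ∀ n < N, Measurable (w n)
  w_indep : ∀ n < N, Indep (𝓖 n) (MeasurableSpace.comap (w n) inferInstance) P
  w_four : ∀ n < N, Integrable (fun ω => w n ω ^ 4) P
  w_four_le : ∀ n < N, ∫ ω, w n ω ^ 4 ∂P ≤ c * δ ^ 2
  ξ_le : ∀ n < N, ∀ ω, |ξ n ω| ≤ B * (E n ω + 1) * w n ω
  η_nonneg : ∀ n < N, ∀ ω, 0 ≤ η n ω
  η_le : ∀ n < N, ∀ ω, η n ω ≤ B * (E n ω + 1) * w n ω ^ 2
  -- The martingale property in weak form. The integrability condition matches the size `(E + 1) w`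
  -- of `ξ`, so that it guarantees integrability of the product.
  orth : ∀ n < N, ∀ g : Ω → ℝ, Measurable[𝓖 n] g → Integrable (fun ω => g ω * (E n ω + 1)) P →
    ∫ ω, g ω * ξ n ω ∂P = 0
  balance : ∀ᵐ ω ∂P, ∀ n < N, E (n + 1) ω + G n ω ≤ E n ω + ξ n ω + η n ω
  initial : ∀ ω, E 0 ω ≤ A

namespace EnergyBalance

variable {P : Measure Ω} [IsProbabilityMeasure P] {N : ℕ} {A B c δ : ℝ}
  {𝓖 : ℕ → MeasurableSpace Ω} {E G ξ η w : ℕ → Ω → ℝ}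

/-- `E n` belongs to the past and `w n` is independent of it, so the expectation factorises. It is
used with `h = x²` for `ξ` and with `h = x⁴` for `η`. -/
theorem integral_sq_mul (H : EnergyBalance P N A B c δ 𝓖 E G ξ η w) {n : ℕ} (hn : n < N)
    (hE : MemLp (E n) 2 P) {h : ℝ → ℝ} (hh : Measurable h)
    (hint : Integrable (fun ω => h (w n ω)) P) :
    Integrable (fun ω => (E n ω + 1) ^ 2 * h (w n ω)) P ∧
      ∫ ω, (E n ω + 1) ^ 2 * h (w n ω) ∂P
        = (∫ ω, (E n ω + 1) ^ 2 ∂P) * ∫ ω, h (w n ω) ∂P := by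
  have hind : IndepFun (fun ω => (E n ω + 1) ^ 2) (fun ω => h (w n ω)) P := by
    refine indep_of_indep_of_le (H.w_indep n hn) ?_ ?_
    · exact (((H.E_meas n).add_const 1).pow_const 2).comap_le
    · exact (hh.comp (comap_measurable (w n))).comap_le
  have hE1 : Integrable (fun ω => (E n ω + 1) ^ 2) P :=
    (hE.add (memLp_const 1)).integrable_sq
  exact ⟨hind.integrable_mul hE1 hint,
    hind.integral_fun_mul_eq_mul_integral hE1.aestronglyMeasurable hint.aestronglyMeasurable⟩

theorem w_sq (H : EnergyBalance P N A B c δ 𝓖 E G ξ η w) (hδ : 0 < δ) {n : ℕ} (hn : n < N) :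
    Integrable (fun ω => w n ω ^ 2) P ∧ ∫ ω, w n ω ^ 2 ∂P ≤ (1 + c) / 2 * δ := by
  -- Young's inequality balanced at `w² = δ`, which keeps the second moment linear in `δ`.
  have hle : ∀ ω, w n ω ^ 2 ≤ δ / 2 + (2 * δ)⁻¹ * w n ω ^ 4 := fun ω => by
    have h : δ / 2 + (2 * δ)⁻¹ * w n ω ^ 4 - w n ω ^ 2 = (2 * δ)⁻¹ * (w n ω ^ 2 - δ) ^ 2 := by
      field_simp
      ring
    have : 0 ≤ (2 * δ)⁻¹ * (w n ω ^ 2 - δ) ^ 2 := by positivity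
    linarith
  have hi : Integrable (fun ω => δ / 2 + (2 * δ)⁻¹ * w n ω ^ 4) P :=
    (integrable_const _).add ((H.w_four n hn).const_mul _)
  have h2 : Integrable (fun ω => w n ω ^ 2) P := by
    refine hi.mono' ((H.w_meas n hn).pow_const 2).aestronglyMeasurable (ae_of_all _ fun ω => ?_)
    rw [Real.norm_of_nonneg (sq_nonneg _)]
    exact hle ω
  refine ⟨h2, (integral_mono h2 hi hle).trans ?_⟩
  rw [integral_add (integrable_const _) ((H.w_four n hn).const_mul _), integral_const_mul,
    integral_const]
  have h3 := mul_le_mul_of_nonneg_left (H.w_four_le n hn) (show 0 ≤ (2 * δ)⁻¹ by positivity)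
  have h4 : (2 * δ)⁻¹ * (c * δ ^ 2) = c / 2 * δ := by
    field_simp
  rw [h4] at h3
  simp only [probReal_univ, smul_eq_mul, one_mul]
  linarith

theorem memLp_ξ (H : EnergyBalance P N A B c δ 𝓖 E G ξ η w) (hδ : 0 < δ)
    {n : ℕ} (hn : n < N) (hE : MemLp (E n) 2 P) :
    MemLp (ξ n) 2 P ∧
      ∫ ω, ξ n ω ^ 2 ∂P ≤ B ^ 2 * ((1 + c) / 2 * δ) * ∫ ω, (E n ω + 1) ^ 2 ∂P := by
  have hm : Measurable (ξ n) := (H.ξ_meas n hn).mono (H.le _) le_rfl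
  obtain ⟨h1, h2⟩ := H.integral_sq_mul hn hE (h := fun x => x ^ 2) (by fun_prop) (H.w_sq hδ hn).1
  have hle : ∀ ω, ξ n ω ^ 2 ≤ B ^ 2 * ((E n ω + 1) ^ 2 * w n ω ^ 2) := fun ω => by
    rw [← sq_abs]
    calc |ξ n ω| ^ 2 ≤ (B * (E n ω + 1) * w n ω) ^ 2 :=
          pow_le_pow_left₀ (abs_nonneg _) (H.ξ_le n hn ω) 2
      _ = _ := by ring
  have hi : Integrable (fun ω => ξ n ω ^ 2) P := by
    refine (h1.const_mul (B ^ 2)).mono' (hm.pow_const 2).aestronglyMeasurable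
      (ae_of_all _ fun ω => ?_)
    rw [Real.norm_of_nonneg (sq_nonneg _)]
    exact hle ω
  refine ⟨(memLp_two_iff_integrable_sq hm.aestronglyMeasurable).2 hi, ?_⟩
  refine (integral_mono hi (h1.const_mul _) hle).trans ?_
  rw [integral_const_mul, h2, mul_assoc (B ^ 2), mul_comm (∫ ω, (E n ω + 1) ^ 2 ∂P)]
  have h3 : 0 ≤ ∫ ω, (E n ω + 1) ^ 2 ∂P := integral_nonneg fun ω => sq_nonneg _
  have h4 := (H.w_sq hδ hn).2
  gcongr

theorem memLp_η (H : EnergyBalance P N A B c δ 𝓖 E G ξ η w)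
    {n : ℕ} (hn : n < N) (hE : MemLp (E n) 2 P) :
    MemLp (η n) 2 P ∧ ∫ ω, η n ω ^ 2 ∂P ≤ B ^ 2 * (c * δ ^ 2) * ∫ ω, (E n ω + 1) ^ 2 ∂P := by
  have hm := H.η_meas n hn
  obtain ⟨h1, h2⟩ := H.integral_sq_mul hn hE (h := fun x => x ^ 4) (by fun_prop) (H.w_four n hn)
  have hle : ∀ ω, η n ω ^ 2 ≤ B ^ 2 * ((E n ω + 1) ^ 2 * w n ω ^ 4) := fun ω => by
    calc η n ω ^ 2 ≤ (B * (E n ω + 1) * w n ω ^ 2) ^ 2 :=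
          pow_le_pow_left₀ (H.η_nonneg n hn ω) (H.η_le n hn ω) 2
      _ = _ := by ring
  have hi : Integrable (fun ω => η n ω ^ 2) P := by
    refine (h1.const_mul (B ^ 2)).mono' (hm.pow_const 2).aestronglyMeasurable
      (ae_of_all _ fun ω => ?_)
    rw [Real.norm_of_nonneg (sq_nonneg _)]
    exact hle ω
  refine ⟨(memLp_two_iff_integrable_sq hm.aestronglyMeasurable).2 hi, ?_⟩
  refine (integral_mono hi (h1.const_mul _) hle).trans ?_
  rw [integral_const_mul, h2, mul_assoc (B ^ 2), mul_comm (∫ ω, (E n ω + 1) ^ 2 ∂P)]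
  have h3 : 0 ≤ ∫ ω, (E n ω + 1) ^ 2 ∂P := integral_nonneg fun ω => sq_nonneg _
  have h4 := H.w_four_le n hn
  gcongr

/-- Square integrability propagates step by step from the deterministic bound on `E 0`, since `ξ n`
and `η n` are in `L²` as soon as `E n` is. -/
theorem memLp_E (H : EnergyBalance P N A B c δ 𝓖 E G ξ η w) (hδ : 0 < δ) :
    ∀ n ≤ N, MemLp (E n) 2 P := by
  have hm : ∀ n, Measurable (E n) := fun n => (H.E_meas n).mono (H.le n) le_rfl
  intro n
  induction n with
  | zero =>
    intro _
    refine (memLp_const A).mono (hm 0).aestronglyMeasurable (ae_of_all _ fun ω => ?_)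
    rw [Real.norm_of_nonneg (H.E_nonneg 0 ω)]
    exact (H.initial ω).trans (le_abs_self A)
  | succ n ih =>
    intro hn
    have hE := ih (by omega)
    refine ((hE.add (H.memLp_ξ hδ hn hE).1).add (H.memLp_η hn hE).1).mono
      (hm (n + 1)).aestronglyMeasurable ?_
    filter_upwards [H.balance] with ω hω
    rw [Real.norm_of_nonneg (H.E_nonneg _ ω)]
    have h1 := hω n hn
    have h2 := H.G_nonneg n ω
    exact (by simp only [Pi.add_apply]; linarith : E (n + 1) ω ≤ (E n + ξ n + η n) ω).trans
      (le_abs_self _)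

/-- The partial sums of the martingale increments. -/
def mart (ξ : ℕ → Ω → ℝ) (ω : Ω) (n : ℕ) : ℝ := ∑ i ∈ Finset.range n, ξ i ω

omit [IsProbabilityMeasure P] in
theorem measurable_mart (H : EnergyBalance P N A B c δ 𝓖 E G ξ η w) {n : ℕ} (hn : n ≤ N) :
    Measurable[𝓖 n] fun ω => mart ξ ω n := by
  refine @Finset.measurable_fun_sum _ _ _ _ _ _ (_) _ _ fun i hi => ?_
  have hi' := Finset.mem_range.1 hi
  exact (H.ξ_meas i (by omega)).mono (H.mono (by omega)) le_rfl

omit [IsProbabilityMeasure P] in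
theorem measurable_absMax_mart (H : EnergyBalance P N A B c δ 𝓖 E G ξ η w) :
    ∀ n ≤ N, Measurable[𝓖 n] fun ω => absMax (mart ξ ω) n := by
  intro n
  induction n with
  | zero =>
    intro hn
    simp_rw [absMax_zero]
    exact continuous_abs.measurable.comp (H.measurable_mart hn)
  | succ n ih =>
    intro hn
    simp_rw [absMax_succ]
    exact ((ih (by omega)).mono (H.mono (Nat.le_succ n)) le_rfl).max
      (continuous_abs.measurable.comp (H.measurable_mart hn))

theorem memLp_mart (H : EnergyBalance P N A B c δ 𝓖 E G ξ η w) (hδ : 0 < δ) {n : ℕ} (hn : n ≤ N) :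
    MemLp (fun ω => mart ξ ω n) 2 P := by
  refine memLp_finsetSum _ fun i hi => ?_
  have hi' := Finset.mem_range.1 hi
  exact (H.memLp_ξ hδ (by omega) (H.memLp_E hδ i (by omega))).1

theorem memLp_absMax_mart (H : EnergyBalance P N A B c δ 𝓖 E G ξ η w) (hδ : 0 < δ) :
    ∀ n ≤ N, MemLp (fun ω => absMax (mart ξ ω) n) 2 P := by
  intro n
  induction n with
  | zero =>
    intro hn
    simp_rw [absMax_zero]
    exact (H.memLp_mart hδ hn).abs
  | succ n ih =>
    intro hn
    simp_rw [absMax_succ]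
    exact (ih (by omega)).sup (H.memLp_mart hδ hn).abs

theorem integrable_mul_E (H : EnergyBalance P N A B c δ 𝓖 E G ξ η w) (hδ : 0 < δ) {n : ℕ}
    (hn : n ≤ N) {g : Ω → ℝ} (hg : MemLp g 2 P) :
    Integrable (fun ω => g ω * (E n ω + 1)) P :=
  hg.integrable_mul ((H.memLp_E hδ n hn).add (memLp_const 1))

theorem integral_sq_mart (H : EnergyBalance P N A B c δ 𝓖 E G ξ η w) (hδ : 0 < δ) :
    ∀ n ≤ N, ∫ ω, mart ξ ω n ^ 2 ∂P = ∑ i ∈ Finset.range n, ∫ ω, ξ i ω ^ 2 ∂P := by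
  intro n
  induction n with
  | zero => simp [mart]
  | succ n ih =>
    intro hn
    have hM := H.memLp_mart hδ (show n ≤ N by omega)
    have hξ := (H.memLp_ξ hδ hn (H.memLp_E hδ n (by omega))).1
    have h1 : ∀ ω, mart ξ ω (n + 1) ^ 2
        = mart ξ ω n ^ 2 + (2 * (mart ξ ω n * ξ n ω) + ξ n ω ^ 2) := fun ω => by
      rw [mart, Finset.sum_range_succ, ← mart]
      ring
    simp_rw [h1]
    have hMξ : Integrable (fun ω => mart ξ ω n * ξ n ω) P := hM.integrable_mul hξ
    have h2 : Integrable (fun ω => 2 * (mart ξ ω n * ξ n ω) + ξ n ω ^ 2) P :=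
      (hMξ.const_mul 2).add hξ.integrable_sq
    rw [integral_add hM.integrable_sq h2,
      integral_add (hMξ.const_mul 2) hξ.integrable_sq, integral_const_mul,
      H.orth n hn _ (H.measurable_mart (by omega)) (H.integrable_mul_E hδ (by omega) hM),
      Finset.sum_range_succ, ih (by omega)]
    ring

/-- Take expectations in the pathwise Doob inequality: its correction is a martingale transform with
predictable weights `absMax * sgn`, hence has mean zero. -/
theorem integral_sq_absMax_mart_le (H : EnergyBalance P N A B c δ 𝓖 E G ξ η w) (hδ : 0 < δ)
    {n : ℕ} (hn : n ≤ N) :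
    ∫ ω, absMax (mart ξ ω) n ^ 2 ∂P ≤ 4 * ∑ i ∈ Finset.range n, ∫ ω, ξ i ω ^ 2 ∂P := by
  rw [← H.integral_sq_mart hδ n hn]
  have hg : ∀ i ≤ N, MemLp (fun ω => absMax (mart ξ ω) i * sgn (mart ξ ω i)) 2 P := fun i hi => by
    have hm : Measurable fun ω => absMax (mart ξ ω) i * sgn (mart ξ ω i) :=
      ((H.measurable_absMax_mart i hi).mono (H.le i) le_rfl).mul
        (measurable_sgn.comp ((H.measurable_mart hi).mono (H.le i) le_rfl))
    refine (H.memLp_absMax_mart hδ i hi).mono hm.aestronglyMeasurable (ae_of_all _ fun ω => ?_)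
    rw [norm_mul, Real.norm_eq_abs (sgn _), abs_sgn, mul_one]
  have hterm : ∀ i ∈ Finset.range n,
      Integrable (fun ω => absMax (mart ξ ω) i * sgn (mart ξ ω i) * ξ i ω) P := fun i hi => by
    have hi' := Finset.mem_range.1 hi
    exact (hg i (by omega)).integrable_mul
      (H.memLp_ξ hδ (by omega) (H.memLp_E hδ i (by omega))).1
  have hzero : ∀ i ∈ Finset.range n,
      ∫ ω, absMax (mart ξ ω) i * sgn (mart ξ ω i) * ξ i ω ∂P = 0 := fun i hi => by
    have hi' := Finset.mem_range.1 hi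
    refine H.orth i (by omega) _ ?_ (H.integrable_mul_E hδ (by omega) (hg i (by omega)))
    exact @Measurable.mul _ _ _ _ _ (_) _ _ (H.measurable_absMax_mart i (by omega))
      (measurable_sgn.comp (H.measurable_mart (by omega)))
  have hM := (H.memLp_mart hδ hn).integrable_sq
  have hsum := integrable_finsetSum _ hterm
  calc ∫ ω, absMax (mart ξ ω) n ^ 2 ∂P
      ≤ ∫ ω, (4 * mart ξ ω n ^ 2
        - 4 * ∑ i ∈ Finset.range n, absMax (mart ξ ω) i * sgn (mart ξ ω i) * ξ i ω) ∂P := by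
        refine integral_mono (H.memLp_absMax_mart hδ n hn).integrable_sq
          ((hM.const_mul 4).sub (hsum.const_mul 4)) fun ω => ?_
        have h := sq_absMax_le (mart ξ ω) n
        have h2 : ∀ i, mart ξ ω (i + 1) - mart ξ ω i = ξ i ω := fun i => by
          rw [mart, Finset.sum_range_succ, ← mart]
          ring
        simpa only [h2] using h
    _ = 4 * ∫ ω, mart ξ ω n ^ 2 ∂P := by
        rw [integral_sub (hM.const_mul 4) (hsum.const_mul 4), integral_const_mul,
          integral_const_mul, integral_finsetSum _ hterm, Finset.sum_eq_zero hzero]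
        ring

/-- A pathwise upper bound for the energy and the dissipation up to step `n`. -/
def bound (A : ℝ) (ξ η : ℕ → Ω → ℝ) (n : ℕ) (ω : Ω) : ℝ :=
  A + absMax (mart ξ ω) n + ∑ i ∈ Finset.range n, η i ω

omit [IsProbabilityMeasure P] in
theorem le_bound (H : EnergyBalance P N A B c δ 𝓖 E G ξ η w) :
    ∀ᵐ ω ∂P, ∀ n ≤ N, E n ω + ∑ i ∈ Finset.range n, G i ω ≤ bound A ξ η n ω := by
  filter_upwards [H.balance] with ω hω
  have h : ∀ n ≤ N, E n ω + ∑ i ∈ Finset.range n, G i ω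
      ≤ A + mart ξ ω n + ∑ i ∈ Finset.range n, η i ω := by
    intro n
    induction n with
    | zero => simpa [mart] using H.initial ω
    | succ n ih =>
      intro hn
      have h1 := ih (by omega)
      have h2 := hω n hn
      simp only [mart, Finset.sum_range_succ] at h1 ⊢
      linarith
  intro n hn
  have h1 := h n hn
  have h2 := (le_abs_self _).trans (abs_le_absMax (mart ξ ω) n)
  unfold bound
  linarith

omit [IsProbabilityMeasure P] in
theorem bound_mono (H : EnergyBalance P N A B c δ 𝓖 E G ξ η w) (ω : Ω) {n : ℕ} (hn : n ≤ N) :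
    bound A ξ η n ω ≤ bound A ξ η N ω := by
  unfold bound
  have h1 := absMax_mono (mart ξ ω) hn
  have h2 : ∑ i ∈ Finset.range n, η i ω ≤ ∑ i ∈ Finset.range N, η i ω :=
    Finset.sum_le_sum_of_subset_of_nonneg (Finset.range_mono hn)
      fun i hi _ => H.η_nonneg i (Finset.mem_range.1 hi) ω
  linarith

theorem memLp_bound (H : EnergyBalance P N A B c δ 𝓖 E G ξ η w) (hδ : 0 < δ) {n : ℕ}
    (hn : n ≤ N) : MemLp (bound A ξ η n) 2 P := by
  refine ((memLp_const A).add (H.memLp_absMax_mart hδ n hn)).add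
    (memLp_finsetSum _ fun i hi => ?_)
  have hi' := Finset.mem_range.1 hi
  exact (H.memLp_η (by omega) (H.memLp_E hδ i (by omega))).1

theorem integral_sq_bound_le (H : EnergyBalance P N A B c δ 𝓖 E G ξ η w) (hδ : 0 < δ) {n : ℕ}
    (hn : n ≤ N) :
    ∫ ω, bound A ξ η n ω ^ 2 ∂P ≤ 3 * A ^ 2 + 12 * ∑ i ∈ Finset.range n, ∫ ω, ξ i ω ^ 2 ∂P
      + 3 * n * ∑ i ∈ Finset.range n, ∫ ω, η i ω ^ 2 ∂P := by
  have hη : ∀ i ∈ Finset.range n, Integrable (fun ω => η i ω ^ 2) P := fun i hi => by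
    have hi' := Finset.mem_range.1 hi
    exact (H.memLp_η (by omega) (H.memLp_E hδ i (by omega))).1.integrable_sq
  have hS := (H.memLp_absMax_mart hδ n hn).integrable_sq
  have hsum := integrable_finsetSum _ hη
  calc ∫ ω, bound A ξ η n ω ^ 2 ∂P
      ≤ ∫ ω, (3 * A ^ 2 + 3 * absMax (mart ξ ω) n ^ 2
        + 3 * n * ∑ i ∈ Finset.range n, η i ω ^ 2) ∂P := by
        refine integral_mono (H.memLp_bound hδ hn).integrable_sq
          (((integrable_const _).add (hS.const_mul 3)).add (hsum.const_mul _)) fun ω => ?_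
        -- Cauchy–Schwarz on the corrections costs a factor `n`, compensated later by `∫ η² =
        -- O(δ²)`.
        have h := sq_sum_le_card_mul_sum_sq (s := Finset.range n) (f := fun i => η i ω)
        rw [Finset.card_range] at h
        simp only [bound]
        generalize absMax (mart ξ ω) n = s at *
        generalize ∑ i ∈ Finset.range n, η i ω = t at *
        nlinarith [sq_nonneg (A - s), sq_nonneg (A - t), sq_nonneg (s - t)]
    _ = 3 * A ^ 2 + 3 * ∫ ω, absMax (mart ξ ω) n ^ 2 ∂P
        + 3 * n * ∑ i ∈ Finset.range n, ∫ ω, η i ω ^ 2 ∂P := by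
        have h2 : Integrable (fun ω => 3 * A ^ 2 + 3 * absMax (mart ξ ω) n ^ 2) P :=
          (integrable_const _).add (hS.const_mul 3)
        rw [integral_add h2 (hsum.const_mul _),
          integral_add (integrable_const _) (hS.const_mul 3),
          integral_const_mul 3 (fun ω => absMax (mart ξ ω) n ^ 2),
          integral_const_mul (3 * (n : ℝ)), integral_finsetSum _ hη]
        simp
    _ ≤ _ := by
        have := H.integral_sq_absMax_mart_le hδ hn
        linarith

/-- Second moment bound for the pathwise upper bound of a stochastic energy inequality, uniform in
the number of steps. -/
theorem integral_sq_bound_le_exp (H : EnergyBalance P N A B c δ 𝓖 E G ξ η w) (hδ : 0 < δ)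
    (hc : 0 ≤ c) {κ : ℝ} (hκ : κ = B ^ 2 * (6 * (1 + c) + 3 * (N * δ) * c)) :
    ∫ ω, bound A ξ η N ω ^ 2 ∂P
      ≤ (3 * A ^ 2 + 2 * κ * (N * δ)) * Real.exp (2 * κ * (N * δ)) := by
  have hκ0 : 0 ≤ κ := by rw [hκ]; positivity
  have hy : ∀ n ≤ N, ∫ ω, (E n ω + 1) ^ 2 ∂P ≤ 2 * ∫ ω, bound A ξ η n ω ^ 2 ∂P + 2 := by
    intro n hn
    have hE := H.memLp_E hδ n hn
    have hZ := (H.memLp_bound hδ hn).integrable_sq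
    calc ∫ ω, (E n ω + 1) ^ 2 ∂P ≤ ∫ ω, (2 * bound A ξ η n ω ^ 2 + 2) ∂P := by
          refine integral_mono_ae (hE.add (memLp_const 1)).integrable_sq
            ((hZ.const_mul 2).add (integrable_const _)) ?_
          filter_upwards [H.le_bound] with ω hω
          have h1 := hω n hn
          have h2 : 0 ≤ ∑ i ∈ Finset.range n, G i ω :=
            Finset.sum_nonneg fun i _ => H.G_nonneg i ω
          have h3 := H.E_nonneg n ω
          have h4 : E n ω ^ 2 ≤ bound A ξ η n ω ^ 2 := pow_le_pow_left₀ h3 (by linarith) 2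
          nlinarith [sq_nonneg (E n ω - 1)]
      _ = _ := by
          rw [integral_add (hZ.const_mul 2) (integrable_const _), integral_const_mul]
          simp
  have hrec : ∀ n ≤ N, ∫ ω, bound A ξ η n ω ^ 2 ∂P ≤ (3 * A ^ 2 + 2 * κ * (N * δ))
      + 2 * κ * δ * ∑ i ∈ Finset.range n, ∫ ω, bound A ξ η i ω ^ 2 ∂P := by
    intro n hn
    have hnN : (n : ℝ) ≤ N := by exact_mod_cast hn
    have h1 := H.integral_sq_bound_le hδ hn
    -- Here `κ` is determined: the martingale part contributes `12 B² (1 + c) / 2` and the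
    -- corrections `3 (N δ) B² c`, each multiplied by `δ`.
    have h2 : ∀ i ∈ Finset.range n, 12 * ∫ ω, ξ i ω ^ 2 ∂P + 3 * n * ∫ ω, η i ω ^ 2 ∂P
        ≤ κ * δ * (2 * ∫ ω, bound A ξ η i ω ^ 2 ∂P + 2) := by
      intro i hi
      have hi' := Finset.mem_range.1 hi
      have hE := H.memLp_E hδ i (by omega)
      have hξ := (H.memLp_ξ hδ (by omega) hE).2
      have hη := (H.memLp_η (by omega) hE).2
      have hE0 : 0 ≤ ∫ ω, (E i ω + 1) ^ 2 ∂P := integral_nonneg fun ω => sq_nonneg _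
      have hη0 : 0 ≤ ∫ ω, η i ω ^ 2 ∂P := integral_nonneg fun ω => sq_nonneg _
      calc 12 * ∫ ω, ξ i ω ^ 2 ∂P + 3 * n * ∫ ω, η i ω ^ 2 ∂P
          ≤ 12 * (B ^ 2 * ((1 + c) / 2 * δ) * ∫ ω, (E i ω + 1) ^ 2 ∂P)
            + 3 * N * (B ^ 2 * (c * δ ^ 2) * ∫ ω, (E i ω + 1) ^ 2 ∂P) := by gcongr
        _ = κ * δ * ∫ ω, (E i ω + 1) ^ 2 ∂P := by rw [hκ]; ring
        _ ≤ _ := by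
          have := hy i (by omega)
          gcongr
    have h3 := Finset.sum_le_sum h2
    rw [Finset.sum_add_distrib, ← Finset.mul_sum, ← Finset.mul_sum, ← Finset.mul_sum,
      Finset.sum_add_distrib, ← Finset.mul_sum, Finset.sum_const, Finset.card_range,
      nsmul_eq_mul] at h3
    have h4 : κ * δ * (n * 2) ≤ κ * δ * (N * 2) := by gcongr
    nlinarith
  refine (discrete_gronwall (by positivity) hrec N le_rfl).trans ?_
  -- The number of steps now enters only through the total time `N δ`.
  have h5 : (1 + 2 * κ * δ) ^ N ≤ Real.exp (2 * κ * (N * δ)) := by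
    calc (1 + 2 * κ * δ) ^ N ≤ Real.exp (2 * κ * δ) ^ N := by
          refine pow_le_pow_left₀ (by positivity) ?_ N
          rw [add_comm]
          exact Real.add_one_le_exp _
      _ = _ := by
          rw [← Real.exp_nat_mul]
          congr 1
          ring
  gcongr

end EnergyBalance

/-! ### The primitive `Ξ`, the energy and the diffusion form. -/

namespace StefanData

variable {d : ℕ} (S : StefanData d)

section Primitive

theorem Xi_sub (a b : ℝ) :
    Xi S.ζ a - Xi S.ζ b = ∫ t in (0 : ℝ)..1, (a - b) * S.ζ (b + (a - b) * t) := by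
  have hi : ∀ x y : ℝ, IntervalIntegrable S.ζ volume x y := fun x y =>
    S.lipschitz.continuous.intervalIntegrable x y
  rw [intervalIntegral.integral_const_mul, intervalIntegral.mul_integral_comp_add_mul, Xi, Xi,
    intervalIntegral.integral_interval_sub_left (hi _ _) (hi _ _)]
  simp

theorem le_Xi_sub (a b : ℝ) : S.ζ b * (a - b) ≤ Xi S.ζ a - Xi S.ζ b := by
  have hc := S.lipschitz.continuous
  rw [S.Xi_sub]
  calc S.ζ b * (a - b) = ∫ _ in (0 : ℝ)..1, S.ζ b * (a - b) := by simp
    _ ≤ _ := by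
      refine intervalIntegral.integral_mono_on zero_le_one (by simp)
        (Continuous.intervalIntegrable (by fun_prop) _ _) fun t ht => ?_
      rw [mul_comm]
      rcases le_total 0 (a - b) with h | h
      · exact mul_le_mul_of_nonneg_left (S.monotone (by nlinarith [mul_nonneg h ht.1])) h
      · exact mul_le_mul_of_nonpos_left
          (S.monotone (by nlinarith [mul_nonneg (neg_nonneg.2 h) ht.1])) h

theorem Xi_sub_le (a b : ℝ) :
    Xi S.ζ a - Xi S.ζ b ≤ S.ζ b * (a - b) + (a - b) ^ 2 / (2 * S.Lζ) := by
  have hc := S.lipschitz.continuous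
  have hL : (0 : ℝ) < S.Lζ := S.Lζ_pos
  rw [S.Xi_sub]
  calc ∫ t in (0 : ℝ)..1, (a - b) * S.ζ (b + (a - b) * t)
      ≤ ∫ t in (0 : ℝ)..1, (S.ζ b * (a - b) + (a - b) ^ 2 / S.Lζ * t) := by
        refine intervalIntegral.integral_mono_on zero_le_one
          (Continuous.intervalIntegrable (by fun_prop) _ _)
          (Continuous.intervalIntegrable (by fun_prop) _ _) fun t ht => ?_
        have h1 := S.lipschitz.dist_le_mul (b + (a - b) * t) b
        rw [Real.dist_eq, Real.dist_eq, add_sub_cancel_left, abs_mul, abs_of_nonneg ht.1,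
          NNReal.coe_inv] at h1
        have h2 : (a - b) * (S.ζ (b + (a - b) * t) - S.ζ b)
            ≤ |a - b| * ((S.Lζ : ℝ)⁻¹ * (|a - b| * t)) := by
          refine (le_abs_self _).trans ?_
          rw [abs_mul]
          gcongr
        have h3 : |a - b| * ((S.Lζ : ℝ)⁻¹ * (|a - b| * t)) = (a - b) ^ 2 / S.Lζ * t := by
          rw [← sq_abs (a - b)]
          ring
        linarith
    _ = _ := by
      rw [intervalIntegral.integral_add (by simp) (Continuous.intervalIntegrable (by fun_prop) _ _),
        intervalIntegral.integral_const_mul ((a - b) ^ 2 / (S.Lζ : ℝ)), integral_id]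
      simp
      ring

/-- Convexity of `Ξ`, improved by the Lipschitz bound on `ζ = Ξ'`. -/
theorem Xi_bregman (a b : ℝ) :
    Xi S.ζ a - Xi S.ζ b ≤ S.ζ a * (a - b) - S.Lζ / 2 * (S.ζ a - S.ζ b) ^ 2 := by
  have hL : (0 : ℝ) < S.Lζ := S.Lζ_pos
  -- Compare the tangent line at `a` with the quadratic upper bound at `b`, both evaluated at `b -
  -- Lζ (ζ b - ζ a)`; this point minimises their difference and so gives the constant `Lζ / 2`.
  have h1 := S.le_Xi_sub (b - S.Lζ * (S.ζ b - S.ζ a)) a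
  have h2 := S.Xi_sub_le (b - S.Lζ * (S.ζ b - S.ζ a)) b
  have h3 : (b - S.Lζ * (S.ζ b - S.ζ a) - b) ^ 2 / (2 * S.Lζ) = S.Lζ / 2 * (S.ζ a - S.ζ b) ^ 2 := by
    field_simp
    ring
  rw [h3] at h2
  nlinarith

theorem Xi_zero : Xi S.ζ 0 = 0 := by simp [Xi]

theorem Xi_nonneg (a : ℝ) : 0 ≤ Xi S.ζ a := by
  have h := S.le_Xi_sub a 0
  rw [S.map_zero, S.Xi_zero] at h
  linarith

theorem Xi_le_sq (a : ℝ) : Xi S.ζ a ≤ a ^ 2 / (2 * S.Lζ) := by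
  have h := S.Xi_sub_le a 0
  rw [S.map_zero, S.Xi_zero] at h
  simpa using h

theorem sq_ζ_le (a : ℝ) : S.Lζ / 2 * S.ζ a ^ 2 ≤ Xi S.ζ a := by
  have h := S.Xi_bregman 0 a
  rw [S.map_zero, S.Xi_zero] at h
  nlinarith

theorem continuous_Xi : Continuous (Xi S.ζ) :=
  intervalIntegral.continuous_primitive
    (fun x y => S.lipschitz.continuous.intervalIntegrable x y) 0

end Primitive

section Energy

theorem coeFn_ζL2 (w : S.L2) : S.ζL2 w =ᵐ[S.μ] fun x => S.ζ (w x) :=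
  S.lipschitz.coeFn_compLp S.map_zero w

theorem continuous_ζL2 : Continuous S.ζL2 := S.lipschitz.continuous_compLp S.map_zero

theorem integrable_sq_L2 (w : S.L2) : Integrable (fun x => w x ^ 2) S.μ :=
  (Lp.memLp w).integrable_sq

theorem norm_sq_L2 (w : S.L2) : ‖w‖ ^ 2 = ∫ x, w x ^ 2 ∂S.μ := by
  rw [← real_inner_self_eq_norm_sq, L2.inner_def]
  refine integral_congr_ae (ae_of_all _ fun x => ?_)
  simp [sq]

theorem integrable_Xi (w : S.L2) : Integrable (fun x => Xi S.ζ (w x)) S.μ := by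
  refine ((S.integrable_sq_L2 w).div_const (2 * S.Lζ)).mono'
    (S.continuous_Xi.comp_aestronglyMeasurable (Lp.aestronglyMeasurable w))
    (ae_of_all _ fun x => ?_)
  rw [Real.norm_of_nonneg (S.Xi_nonneg _)]
  exact S.Xi_le_sq _

/-- The energy `∫_Θ Ξ(w)`. -/
def energy (w : S.L2) : ℝ := ∫ x, Xi S.ζ (w x) ∂S.μ

theorem energy_nonneg (w : S.L2) : 0 ≤ S.energy w := integral_nonneg fun _ => S.Xi_nonneg _

theorem norm_sq_ζL2_le (w : S.L2) : ‖S.ζL2 w‖ ^ 2 ≤ 2 / S.Lζ * S.energy w := by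
  have hL : (0 : ℝ) < S.Lζ := S.Lζ_pos
  rw [norm_sq_L2, energy, ← integral_const_mul]
  refine integral_mono_ae (S.integrable_sq_L2 _) ((S.integrable_Xi w).const_mul _) ?_
  filter_upwards [S.coeFn_ζL2 w] with x hx
  rw [hx]
  have h := mul_le_mul_of_nonneg_left (S.sq_ζ_le (w x)) (show 0 ≤ 2 / (S.Lζ : ℝ) by positivity)
  calc S.ζ (w x) ^ 2 = 2 / (S.Lζ : ℝ) * (S.Lζ / 2 * S.ζ (w x) ^ 2) := by field_simp
    _ ≤ _ := h

theorem exists_norm_sq_le :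
    ∃ a ≥ (0 : ℝ), ∀ w : S.L2, ‖w‖ ^ 2 ≤ a * (S.energy w + 1) := by
  obtain ⟨c, hc, b, -, hcoer⟩ := S.coercive
  have hbound : ∀ w : S.L2,
      ‖w‖ ^ 2 ≤ (4 / c) * S.energy w + 4 * b ^ 2 / c ^ 2 * S.μ.real Set.univ := by
    intro w
    have hi := (S.integrable_Xi w).const_mul (4 / c)
    rw [norm_sq_L2, energy, ← integral_const_mul]
    calc ∫ x, w x ^ 2 ∂S.μ ≤ ∫ x, (4 / c * Xi S.ζ (w x) + 4 * b ^ 2 / c ^ 2) ∂S.μ :=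
          integral_mono (S.integrable_sq_L2 w) (hi.add (integrable_const _)) fun x =>
            sq_le_Xi S.lipschitz.continuous S.monotone S.map_zero hc hcoer (w x)
      _ = _ := by
        rw [integral_add hi (integrable_const _), integral_const, smul_eq_mul,
          mul_comm (S.μ.real _)]
  have h1 : 0 ≤ 4 / c := by positivity
  have h2 : 0 ≤ 4 * b ^ 2 / c ^ 2 * S.μ.real Set.univ := by positivity
  refine ⟨4 / c + 4 * b ^ 2 / c ^ 2 * S.μ.real Set.univ, by positivity, fun w => ?_⟩
  nlinarith [hbound w, S.energy_nonneg w, mul_nonneg h2 (S.energy_nonneg w)]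

theorem inner_L2 (v w : S.L2) : ⟪v, w⟫ = ∫ x, v x * w x ∂S.μ := by
  rw [L2.inner_def]
  refine integral_congr_ae (ae_of_all _ fun x => ?_)
  simp [mul_comm]

theorem integrable_mul_L2 (v w : S.L2) : Integrable (fun x => v x * w x) S.μ :=
  (Lp.memLp v).integrable_mul (Lp.memLp w)

theorem energy_sub_le (a b : S.L2) :
    S.energy a - S.energy b ≤ ⟪a - b, S.ζL2 a⟫ - S.Lζ / 2 * ‖S.ζL2 a - S.ζL2 b‖ ^ 2 := by
  have h1 := S.integrable_mul_L2 (a - b) (S.ζL2 a)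
  have h2 := S.integrable_sq_L2 (S.ζL2 a - S.ζL2 b)
  rw [energy, energy, ← integral_sub (S.integrable_Xi a) (S.integrable_Xi b), inner_L2, norm_sq_L2,
    ← integral_const_mul, ← integral_sub h1 (h2.const_mul _)]
  refine integral_mono_ae ((S.integrable_Xi a).sub (S.integrable_Xi b)) (h1.sub (h2.const_mul _)) ?_
  filter_upwards [S.coeFn_ζL2 a, S.coeFn_ζL2 b, Lp.coeFn_sub a b,
    Lp.coeFn_sub (S.ζL2 a) (S.ζL2 b)] with x ha hb hab hζ
  rw [hab, hζ, Pi.sub_apply, Pi.sub_apply, ha, hb, mul_comm (a x - b x)]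
  exact S.Xi_bregman (a x) (b x)

/-- Convexity squeezes `S.energy a - S.energy b` between `⟪a - b, ζ(b)⟫` and `⟪a - b, ζ(a)⟫`, and
both tend to zero as `a → b`. -/
theorem continuous_energy : Continuous S.energy := by
  have hL : (0 : ℝ) < S.Lζ := S.Lζ_pos
  have hle : ∀ a b : S.L2, S.energy a - S.energy b ≤ ⟪a - b, S.ζL2 a⟫ := fun a b => by
    have h : 0 ≤ S.Lζ / 2 * ‖S.ζL2 a - S.ζL2 b‖ ^ 2 := by positivity
    linarith [S.energy_sub_le a b]
  have hζ := S.continuous_ζL2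
  refine continuous_iff_continuousAt.2 fun b => ?_
  have h1 : Tendsto (fun a => S.energy b + ⟪a - b, S.ζL2 a⟫) (𝓝 b) (𝓝 (S.energy b)) := by
    have : Continuous fun a => S.energy b + ⟪a - b, S.ζL2 a⟫ := by fun_prop
    simpa using this.tendsto b
  have h2 : Tendsto (fun a => S.energy b - ⟪b - a, S.ζL2 b⟫) (𝓝 b) (𝓝 (S.energy b)) := by
    have : Continuous fun a => S.energy b - ⟪b - a, S.ζL2 b⟫ := by fun_prop
    simpa using this.tendsto b
  exact tendsto_of_tendsto_of_tendsto_of_le_of_le h2 h1 (fun a => by linarith [hle b a])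
    fun a => by linarith [hle a b]

end Energy

section Diffusion

theorem sum_single_form (A : Matrix (Fin d) (Fin d) ℝ) (k l : Fin d) (s t : ℝ) :
    ∑ i, ∑ j, A i j * (EuclideanSpace.single k s + EuclideanSpace.single l t : Space d) j
      * (EuclideanSpace.single k s + EuclideanSpace.single l t : Space d) i
      = s * s * A k k + s * t * (A k l + A l k) + t * t * A l l := by
  classical
  simp only [PiLp.add_apply, PiLp.single_apply, mul_add, add_mul, Finset.sum_add_distrib,
    mul_ite, ite_mul, mul_zero, zero_mul]
  simp [Finset.sum_add_distrib]
  ring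

/-- Polarisation: the form is tested on `e_i + e_j` and `e_i - e_j`, and symmetry isolates the
entry. Bounded entries make `⟨Λ F, G⟩` integrable, hence linear in `G`. -/
theorem exists_abs_Λ_le : ∃ M, ∀ᵐ x ∂S.μ, ∀ i j, |S.Λ x i j| ≤ M := by
  obtain ⟨lo, hlo, hi, hhi, hell⟩ := S.Λ_elliptic
  refine ⟨2 * hi, ?_⟩
  filter_upwards [hell, S.Λ_symm] with x hx hsymm i j
  have hn : ∀ s t : ℝ, ‖(EuclideanSpace.single i s + EuclideanSpace.single j t : Space d)‖ ^ 2
      ≤ 2 * (s ^ 2 + t ^ 2) := fun s t => by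
    have h1 := norm_add_le (EuclideanSpace.single i s : Space d) (EuclideanSpace.single j t)
    rw [PiLp.norm_single, PiLp.norm_single, Real.norm_eq_abs,
      Real.norm_eq_abs] at h1
    have h2 := pow_le_pow_left₀ (norm_nonneg _) h1 2
    nlinarith [sq_abs s, sq_abs t, sq_nonneg (|s| - |t|)]
  have hb : ∀ s t : ℝ, 0 ≤ s * s * S.Λ x i i + s * t * (S.Λ x i j + S.Λ x j i)
      + t * t * S.Λ x j j ∧ s * s * S.Λ x i i + s * t * (S.Λ x i j + S.Λ x j i)
      + t * t * S.Λ x j j ≤ hi * (2 * (s ^ 2 + t ^ 2)) := fun s t => by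
    rw [← sum_single_form]
    obtain ⟨h1, h2⟩ := hx (EuclideanSpace.single i s + EuclideanSpace.single j t)
    refine ⟨le_trans (by positivity) h1, h2.trans ?_⟩
    exact mul_le_mul_of_nonneg_left (hn s t) hhi.le
  have hs : S.Λ x j i = S.Λ x i j := hsymm.apply i j
  have h11 := hb 1 1
  have h12 := hb 1 (-1)
  rw [hs] at h11 h12
  rw [abs_le]
  constructor <;> nlinarith

theorem integrable_lam (F G : S.L2d) :
    Integrable (fun x => ∑ i, ∑ j, S.Λ x i j * F x j * G x i) S.μ := by
  obtain ⟨M, hM⟩ := S.exists_abs_Λ_le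
  have hcoord : ∀ (F : S.L2d) (j : Fin d), MemLp (fun x => F x j) 2 S.μ := fun F j =>
    (EuclideanSpace.proj (𝕜 := ℝ) j).comp_memLp' (Lp.memLp F)
  refine integrable_finsetSum _ fun i _ => integrable_finsetSum _ fun j _ => ?_
  have h : Integrable (fun x => F x j * G x i) S.μ := (hcoord F j).integrable_mul (hcoord G i)
  simp_rw [mul_assoc]
  exact h.bdd_mul (c := M) (S.Λ_meas i j).aestronglyMeasurable (hM.mono fun x hx => hx i j)

/-- `G ↦ ⟨Λ F, G⟩` as a linear map. -/
def lamLin (F : S.L2d) : S.L2d →ₗ[ℝ] ℝ where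
  toFun := S.lamInner F
  map_add' G H := by
    simp only [lamInner]
    rw [← integral_add (S.integrable_lam F G) (S.integrable_lam F H)]
    refine integral_congr_ae ?_
    filter_upwards [Lp.coeFn_add G H] with x hx
    simp only [hx, Pi.add_apply, PiLp.add_apply, mul_add, Finset.sum_add_distrib]
  map_smul' a G := by
    simp only [lamInner, RingHom.id_apply, smul_eq_mul]
    rw [← integral_const_mul]
    refine integral_congr_ae ?_
    filter_upwards [Lp.coeFn_smul a G] with x hx
    simp only [hx, Pi.smul_apply, PiLp.smul_apply, smul_eq_mul, Finset.mul_sum]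
    refine Finset.sum_congr rfl fun i _ => Finset.sum_congr rfl fun j _ => ?_
    ring

theorem exists_le_lamInner : ∃ lo > 0, ∀ F : S.L2d, lo * ‖F‖ ^ 2 ≤ S.lamInner F F := by
  obtain ⟨lo, hlo, hi, hhi, hell⟩ := S.Λ_elliptic
  refine ⟨lo, hlo, fun F => ?_⟩
  have h : ‖F‖ ^ 2 = ∫ x, ‖F x‖ ^ 2 ∂S.μ := by
    rw [← real_inner_self_eq_norm_sq, L2.inner_def]
    simp only [real_inner_self_eq_norm_sq]
  rw [h, lamInner, ← integral_const_mul]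
  refine integral_mono_ae ((Lp.memLp F).norm.integrable_sq.const_mul _) (S.integrable_lam F F) ?_
  filter_upwards [hell] with x hx using (hx (F x)).1

end Diffusion

end StefanData

/-! ### Operator-norm consequences of the Hilbert–Schmidt assumptions on `f`. -/

section HilbertSchmidt

variable {κ K H : Type*} [NormedAddCommGroup K] [InnerProductSpace ℝ K] [CompleteSpace K]
  [NormedAddCommGroup H] [InnerProductSpace ℝ H] [CompleteSpace H]

/-- By Parseval, `‖A* y‖² = ∑ ⟪A e_k, y⟫²`, to which Cauchy–Schwarz applies term by term; `A` and
its adjoint have the same norm. -/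
theorem enorm_sq_le_hsNormSq (e : HilbertBasis κ ℝ K) (A : K →L[ℝ] H) :
    ‖A‖ₑ ^ 2 ≤ hsNormSq e A := by
  by_cases htop : hsNormSq e A = ∞
  · rw [htop]; exact le_top
  have hs : ∀ x : H, ‖x‖ₑ ^ 2 = ENNReal.ofReal (‖x‖ ^ 2) := fun x => by
    rw [ENNReal.ofReal_pow (norm_nonneg _), ofReal_norm]
  have hsum : Summable fun k => ‖A (e k)‖ ^ 2 := by
    have := ENNReal.summable_toReal htop
    simp_rw [hs] at this
    simpa using this
  have heq : hsNormSq e A = ENNReal.ofReal (∑' k, ‖A (e k)‖ ^ 2) := by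
    rw [hsNormSq, ENNReal.ofReal_tsum_of_nonneg (fun _ => sq_nonneg _) hsum]
    simp_rw [hs]
  have hle : ‖A.adjoint‖ ≤ √(∑' k, ‖A (e k)‖ ^ 2) := by
    refine ContinuousLinearMap.opNorm_le_bound _ (Real.sqrt_nonneg _) fun y => ?_
    refine abs_le_of_sq_le_sq' ?_ (by positivity) |>.2
    rw [mul_pow, Real.sq_sqrt (tsum_nonneg fun _ => sq_nonneg _), ← tsum_mul_right]
    have h := hasSum_sq_inner_hilbertBasis e (A.adjoint y)
    rw [← h.tsum_eq]
    refine h.summable.tsum_le_tsum (fun k => ?_) (hsum.mul_right _)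
    rw [ContinuousLinearMap.adjoint_inner_right, ← mul_pow, ← sq_abs]
    exact pow_le_pow_left₀ (abs_nonneg _) (abs_real_inner_le_norm _ _) 2
  have hA : ‖A‖ ^ 2 ≤ ∑' k, ‖A (e k)‖ ^ 2 := by
    rw [← LinearIsometryEquiv.norm_map ContinuousLinearMap.adjoint A,
      ← Real.sq_sqrt (tsum_nonneg fun k => sq_nonneg ‖A (e k)‖)]
    exact pow_le_pow_left₀ (norm_nonneg _) hle 2
  rw [heq, ← ofReal_norm, ← ENNReal.ofReal_pow (norm_nonneg _)]
  exact ENNReal.ofReal_le_ofReal hA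

variable {d : ℕ} {S : StefanData d} {e : HilbertBasis κ ℝ K}

theorem NoiseCoeff.continuous_f (F : NoiseCoeff S e) : Continuous F.f := by
  refine continuous_iff_continuousAt.2 fun w => ?_
  rw [ContinuousAt, tendsto_iff_norm_sub_tendsto_zero]
  have h1 : Tendsto (fun v => ‖F.f v - F.f w‖ₑ ^ 2) (𝓝 w) (𝓝 0) :=
    tendsto_of_tendsto_of_tendsto_of_le_of_le tendsto_const_nhds (F.continuous w)
      (fun _ => zero_le) fun v => enorm_sq_le_hsNormSq e _
  have h2 : Tendsto (fun v => √((‖F.f v - F.f w‖ₑ ^ 2).toReal)) (𝓝 w) (𝓝 0) := by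
    have h := (ENNReal.tendsto_toReal (by simp : (0 : ℝ≥0∞) ≠ ∞)).comp h1
    simpa [Function.comp_def] using (Real.continuous_sqrt.tendsto _).comp h
  simpa using h2

theorem NoiseCoeff.exists_norm_sq_le (F : NoiseCoeff S e) :
    ∃ a ≥ (0 : ℝ), ∀ w, ‖F.f (S.ζL2 w)‖ ^ 2 ≤ a * (S.energy w + 1) := by
  obtain ⟨C₁, h1, C₂, h2, h⟩ := F.growth
  refine ⟨C₁ + C₂, by positivity, fun w => ?_⟩
  have h3 := (enorm_sq_le_hsNormSq e _).trans (h w (S.integrable_Xi w))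
  have hE := S.energy_nonneg w
  change _ ≤ ENNReal.ofReal (C₂ * S.energy w + C₁) at h3
  rw [← ofReal_norm, ← ENNReal.ofReal_pow (norm_nonneg _),
    ENNReal.ofReal_le_ofReal_iff (by positivity)] at h3
  nlinarith

end HilbertSchmidt

/-! ### Spatial reconstruction and its compatibility with `ζ`. -/

namespace GradDisc

variable {d : ℕ} {S : StefanData d} {𝒴 : Set S.L2} (D : GradDisc S 𝒴)

section Space

theorem coeFn_recon (v : D.X) : D.recon v =ᵐ[S.μ] D.reconFun v := (D.memLp_reconFun v).coeFn_toLp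

/-- The reconstruction as a linear map. -/
def reconLin : D.X →ₗ[ℝ] S.L2 where
  toFun := D.recon
  map_add' v w := by
    refine Lp.ext ?_
    filter_upwards [D.coeFn_recon v, D.coeFn_recon w, D.coeFn_recon (v + w),
      Lp.coeFn_add (D.recon v) (D.recon w)] with x h1 h2 h3 h4
    rw [h3, h4, Pi.add_apply, h1, h2]
    simp only [reconFun, ← Finset.sum_add_distrib]
    refine Finset.sum_congr rfl fun i _ => ?_
    by_cases hx : x ∈ D.cell i <;> simp [hx]
  map_smul' a v := by
    refine Lp.ext ?_
    filter_upwards [D.coeFn_recon v, D.coeFn_recon (a • v), Lp.coeFn_smul a (D.recon v)]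
      with x h1 h2 h3
    rw [h2, RingHom.id_apply, h3, Pi.smul_apply, h1]
    simp only [reconFun, smul_eq_mul, Finset.mul_sum]
    refine Finset.sum_congr rfl fun i _ => ?_
    by_cases hx : x ∈ D.cell i <;> simp [hx]

theorem continuous_recon : Continuous D.recon := D.reconLin.continuous_of_finiteDimensional

theorem continuous_grad : Continuous D.grad := D.grad.continuous_of_finiteDimensional

theorem continuous_ζX : Continuous D.ζX :=
  continuous_pi fun i => S.lipschitz.continuous.comp (continuous_apply i)

/-- At most one cell contains `x`, and off all cells `ζ 0 = 0` is used. This is what makes `ζ(u)` a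
test vector that produces the energy. -/
theorem reconFun_ζX (v : D.X) (x : Space d) : D.reconFun (D.ζX v) x = S.ζ (D.reconFun v x) := by
  by_cases h : ∃ i, x ∈ D.cell i
  · obtain ⟨i, hi⟩ := h
    have hj : ∀ j, j ≠ i → x ∉ D.cell j := fun j hj hx =>
      Set.disjoint_left.1 (D.cell_disjoint hj) hx hi
    have hsum : ∀ w : D.X, D.reconFun w x = w i := fun w => by
      rw [reconFun, Finset.sum_eq_single i (fun j _ h => Set.indicator_of_notMem (hj j h) _)
        (fun h => absurd (Finset.mem_univ i) h), Set.indicator_of_mem hi]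
    rw [hsum, hsum, ζX]
  · push Not at h
    have hsum : ∀ w : D.X, D.reconFun w x = 0 := fun w =>
      Finset.sum_eq_zero fun i _ => Set.indicator_of_notMem (h i) _
    rw [hsum, hsum, S.map_zero]

theorem recon_ζX (v : D.X) : D.recon (D.ζX v) = S.ζL2 (D.recon v) := by
  refine Lp.ext ?_
  filter_upwards [D.coeFn_recon v, D.coeFn_recon (D.ζX v), S.coeFn_ζL2 (D.recon v)] with x h1 h2 h3
  rw [h2, h3, h1, reconFun_ζX]

theorem XiInt_eq (v : D.X) : D.XiInt v = ENNReal.ofReal (S.energy (D.recon v)) :=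
  (ofReal_integral_eq_lintegral_ofReal (S.integrable_Xi _) (ae_of_all _ fun _ => S.Xi_nonneg _)).symm

theorem measurable_XiInt : Measurable D.XiInt := by
  simp_rw [funext D.XiInt_eq]
  exact (S.continuous_energy.comp D.continuous_recon).measurable.ennreal_ofReal

end Space

/-! ### Space-time norms as finite expressions in the time index. -/

section Time

theorem dt_pos : 0 < D.dt := div_pos S.T_pos (by exact_mod_cast D.N_pos)

theorem N_mul_dt : (D.N : ℝ) * D.dt = S.T := by
  have : (D.N : ℝ) ≠ 0 := by exact_mod_cast D.N_pos.ne'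
  rw [dt]
  field_simp

theorem measurable_idx : Measurable D.idx := by
  have h : D.idx = (fun k : ℕ => (⟨min k D.N, by omega⟩ : Fin (D.N + 1))) ∘ Nat.ceil ∘
      fun t => t / D.dt := rfl
  rw [h]
  exact (Measurable.of_discrete).comp (Nat.measurable_ceil.comp (by fun_prop))

/-- The law of the time index under Lebesgue measure on `(0, T)`. -/
def idxMeasure : Measure (Fin (D.N + 1)) := (volume.restrict (Set.Ioo 0 S.T)).map D.idx

/-- Index `0` is never attained at a positive time, so the gradient at the initial step, which the
energy inequality does not control, is absent from the space-time norm. -/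
theorem idxMeasure_zero : D.idxMeasure {0} = 0 := by
  rw [idxMeasure, Measure.map_apply D.measurable_idx (measurableSet_singleton _),
    Measure.restrict_apply (D.measurable_idx (measurableSet_singleton _))]
  convert measure_empty (μ := (volume : Measure ℝ))
  rw [Set.eq_empty_iff_forall_notMem]
  rintro t ⟨h1, h2, -⟩
  have h3 : min ⌈t / D.dt⌉₊ D.N = 0 := congrArg Fin.val h1
  have h4 : 0 < ⌈t / D.dt⌉₊ := Nat.ceil_pos.2 (div_pos h2 D.dt_pos)
  have := D.N_pos
  omega

theorem idxMeasure_le (n : Fin (D.N + 1)) : D.idxMeasure {n} ≤ ENNReal.ofReal D.dt := by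
  have hδ := D.dt_pos
  rcases Nat.eq_zero_or_pos n.1 with hn | hn
  · rw [show n = 0 from Fin.ext hn, idxMeasure_zero]
    exact zero_le
  rw [idxMeasure, Measure.map_apply D.measurable_idx (measurableSet_singleton _),
    Measure.restrict_apply (D.measurable_idx (measurableSet_singleton _))]
  have hsub : D.idx ⁻¹' {n} ∩ Set.Ioo 0 S.T ⊆ Set.Ioc ((n - 1) * D.dt) (n * D.dt) := by
    rintro t ⟨h1, h2, h3⟩
    have h4 : min ⌈t / D.dt⌉₊ D.N = n.1 := congrArg Fin.val h1
    have h5 : ⌈t / D.dt⌉₊ ≤ D.N := by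
      rw [Nat.ceil_le, div_le_iff₀ hδ, D.N_mul_dt]
      exact h3.le
    rw [min_eq_left h5] at h4
    have h6 := Nat.le_ceil (t / D.dt)
    have h7 := Nat.ceil_lt_add_one (div_pos h2 hδ).le
    rw [h4] at h6 h7
    rw [div_le_iff₀ hδ] at h6
    rw [← sub_lt_iff_lt_add, lt_div_iff₀ hδ] at h7
    exact ⟨h7, h6⟩
  refine (measure_mono hsub).trans_eq ?_
  rw [Real.volume_Ioc]
  congr 1
  ring

/-- After transport to the finite index set, an essential supremum is the supremum over the indices
of positive mass; this form also yields measurability in `v`. -/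
theorem normLinfL2_eq (v : Fin (D.N + 1) → D.X) :
    D.normLinfL2 v = ⨆ n, ⨆ _ : D.idxMeasure {n} ≠ 0, ‖D.recon (v n)‖ₑ := by
  have h : D.normLinfL2 v = eLpNorm (fun n => D.recon (v n)) ∞ D.idxMeasure := by
    rw [idxMeasure, eLpNorm_map_measure StronglyMeasurable.of_discrete.aestronglyMeasurable
      D.measurable_idx.aemeasurable]
    rfl
  rw [h, eLpNorm_exponent_top, eLpNormEssSup]
  refine le_antisymm ?_ (iSup₂_le fun n hn => ?_)
  · refine essSup_le_of_ae_le _ (ae_iff_of_countable.2 fun n hn => ?_)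
    exact le_iSup₂ (f := fun n (_ : D.idxMeasure {n} ≠ 0) => ‖D.recon (v n)‖ₑ) n hn
  · exact ae_iff_of_countable.1 (ENNReal.ae_le_essSup fun n => ‖D.recon (v n)‖ₑ) n hn

theorem measurable_normLinfL2 : Measurable D.normLinfL2 := by
  rw [funext D.normLinfL2_eq]
  refine Measurable.iSup fun n => Measurable.iSup fun _ => ?_
  exact (continuous_enorm.comp (D.continuous_recon.comp (continuous_apply n))).measurable

theorem normLinfL2_le (v : Fin (D.N + 1) → D.X) : D.normLinfL2 v ≤ ⨆ n, ‖D.recon (v n)‖ₑ := by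
  rw [normLinfL2_eq]
  exact iSup_mono fun n => iSup_le fun _ => le_rfl

theorem measurable_enorm_sq_gradT (v : Fin (D.N + 1) → D.X) :
    Measurable fun p : ℝ × Space d => ‖D.gradT v p.1 p.2‖ₑ ^ 2 := by
  have h1 : ∀ w : Fin (D.N + 1) → S.L2d,
      Measurable fun q : Fin (D.N + 1) × Space d => ‖w q.1 q.2‖ₑ ^ 2 := fun w => by
    refine measurable_from_prod_countable_right fun n => ?_
    have h2 : Measurable (w n : Space d → Space d) := (Lp.stronglyMeasurable (w n)).measurable
    exact h2.enorm.pow_const 2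
  have h3 : Measurable fun p : ℝ × Space d => (D.idx p.1, p.2) :=
    (D.measurable_idx.comp measurable_fst).prodMk measurable_snd
  have h4 := (h1 fun n => D.grad (v n)).comp h3
  simpa only [Function.comp_def, gradT] using h4

theorem _root_.StochStefan.StefanData.lintegral_enorm_sq (F : S.L2d) :
    ∫⁻ x, ‖F x‖ₑ ^ 2 ∂S.μ = ‖F‖ₑ ^ 2 := by
  rw [Lp.enorm_def, eLpNorm_eq_lintegral_rpow_enorm_toReal (by simp) (by simp),
    ← ENNReal.rpow_natCast, ← ENNReal.rpow_mul]
  simp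

theorem normGradL2_sq (v : Fin (D.N + 1) → D.X) :
    D.normGradL2 v ^ 2 = ∑ n, ‖D.grad (v n)‖ₑ ^ 2 * D.idxMeasure {n} := by
  have h2 : D.normGradL2 v ^ 2
      = ∫⁻ p, ‖D.gradT v p.1 p.2‖ₑ ^ 2 ∂((volume.restrict (Set.Ioo 0 S.T)).prod S.μ) := by
    rw [normGradL2, eLpNorm_eq_lintegral_rpow_enorm_toReal (by simp) (by simp),
      ← ENNReal.rpow_natCast, ← ENNReal.rpow_mul]
    simp
  rw [h2, lintegral_prod _ (D.measurable_enorm_sq_gradT v).aemeasurable, ← lintegral_fintype,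
    idxMeasure, lintegral_map Measurable.of_discrete D.measurable_idx]
  simp only [S.lintegral_enorm_sq, gradT]

theorem normGradL2_four (v : Fin (D.N + 1) → D.X) :
    D.normGradL2 v ^ 4 = (∑ n, ‖D.grad (v n)‖ₑ ^ 2 * D.idxMeasure {n}) ^ 2 := by
  rw [← normGradL2_sq, ← pow_mul]

theorem measurable_normGradL2_four : Measurable fun v => D.normGradL2 v ^ 4 := by
  simp_rw [D.normGradL2_four]
  refine Measurable.pow_const (Finset.measurable_fun_sum _ fun n _ => ?_) 2
  exact ((continuous_enorm.comp
    (D.continuous_grad.comp (continuous_apply n))).measurable.pow_const 2).mul_const _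

theorem normGradL2_four_le (v : Fin (D.N + 1) → D.X) :
    D.normGradL2 v ^ 4 ≤
      ENNReal.ofReal ((∑ n : Fin D.N, D.dt * ‖D.grad (v n.succ)‖ ^ 2) ^ 2) := by
  have hδ := D.dt_pos
  rw [normGradL2_four, ENNReal.ofReal_pow (Finset.sum_nonneg fun n _ => by positivity),
    Fin.sum_univ_succ, idxMeasure_zero, mul_zero, zero_add,
    ENNReal.ofReal_sum_of_nonneg fun n _ => by positivity]
  gcongr with n
  rw [ENNReal.ofReal_mul hδ.le, ENNReal.ofReal_pow (norm_nonneg _), ofReal_norm, mul_comm]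
  gcongr
  exact D.idxMeasure_le _

/-- The grid times, extended by the final time. -/
def timeNat (n : ℕ) : Set.Icc (0 : ℝ) S.T := D.time ⟨min n D.N, by omega⟩

theorem timeNat_mono : Monotone D.timeNat := fun m n hmn => by
  have h : ((min m D.N : ℕ) : ℝ) ≤ (min n D.N : ℕ) := by exact_mod_cast min_le_min_right _ hmn
  exact Subtype.mk_le_mk.2 (mul_le_mul_of_nonneg_right h D.dt_pos.le)

theorem timeNat_zero : D.timeNat 0 = ⟨0, le_rfl, S.T_pos.le⟩ := by
  refine Subtype.ext ?_
  simp [timeNat, time]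

theorem timeNat_val (n : Fin (D.N + 1)) : D.timeNat n = D.time n := by
  rw [timeNat]
  congr 1
  exact Fin.ext (min_eq_left (by omega))

theorem timeNat_succ_sub {n : ℕ} (hn : n < D.N) :
    (D.timeNat (n + 1) : ℝ) - D.timeNat n = D.dt := by
  simp only [timeNat, time, dt]
  rw [min_eq_left (by omega), min_eq_left (by omega)]
  push_cast
  ring

end Time

/-! ### The energy inequality over one time step. -/

section Scheme

variable {κ K : Type*} [NormedAddCommGroup K] [InnerProductSpace ℝ K] [MeasurableSpace K]
  {Ω : Type*} [MeasurableSpace Ω] {e : HilbertBasis κ ℝ K} {F : NoiseCoeff S e}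
  {hu0 : S.u0L2 ∈ 𝒴} {P : Measure Ω} {W : Set.Icc (0 : ℝ) S.T → Ω → K}
  {u : Fin (D.N + 1) → Ω → D.X}

variable {D} in
/-- Almost surely, the scheme holds for all (possibly random) test vectors. -/
theorem _root_.StochStefan.IsSolution.scheme_ae (h : IsSolution D F hu0 P W u) :
    ∀ᵐ ω ∂P, ∀ (n : Fin D.N) (φ : D.X),
      ⟪D.recon (u n.succ ω) - D.recon (u n.castSucc ω), D.recon φ⟫
      + D.dt * S.lamInner (D.grad (D.ζX (u n.succ ω))) (D.grad φ)
      = ⟪F.f (D.recon (D.ζX (u n.castSucc ω)))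
          (W (D.time n.succ) ω - W (D.time n.castSucc) ω), D.recon φ⟫ := by
  classical
  -- The exceptional null set depends on the test vector, so only the finitely many basis vectors
  -- are used; the identity is linear in `φ` and extends to all of them.
  filter_upwards [ae_all_iff.2 fun i : D.ι => h.scheme (Pi.single i 1)] with ω hω n φ
  set a := D.recon (u n.succ ω) - D.recon (u n.castSucc ω)
  set b := F.f (D.recon (D.ζX (u n.castSucc ω))) (W (D.time n.succ) ω - W (D.time n.castSucc) ω)
  have heq : (innerₛₗ ℝ a) ∘ₗ D.reconLin
      + D.dt • (S.lamLin (D.grad (D.ζX (u n.succ ω))) ∘ₗ D.grad) = (innerₛₗ ℝ b) ∘ₗ D.reconLin := by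
    refine (Pi.basisFun ℝ D.ι).ext fun i => ?_
    rw [Pi.basisFun_apply]
    exact hω i n
  exact LinearMap.congr_fun heq φ

/-- The energy inequality over one time step. -/
theorem energy_step {lo : ℝ} (hlo : ∀ G : S.L2d, lo * ‖G‖ ^ 2 ≤ S.lamInner G G) {v w : D.X}
    {b : S.L2}
    (h : ⟪D.recon w - D.recon v, D.recon (D.ζX w)⟫
      + D.dt * S.lamInner (D.grad (D.ζX w)) (D.grad (D.ζX w)) = ⟪b, D.recon (D.ζX w)⟫) :
    S.energy (D.recon w) + lo * (D.dt * ‖D.grad (D.ζX w)‖ ^ 2)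
      ≤ S.energy (D.recon v) + ⟪b, D.recon (D.ζX v)⟫ + ‖b‖ ^ 2 / (2 * S.Lζ) := by
  have hL : (0 : ℝ) < S.Lζ := S.Lζ_pos
  have h1 := S.energy_sub_le (D.recon w) (D.recon v)
  rw [← recon_ζX, ← recon_ζX] at h1
  have h2 := mul_le_mul_of_nonneg_left (hlo (D.grad (D.ζX w))) D.dt_pos.le
  -- Moving the test vector from `w` back to `v` makes the noise term adapted. Young's inequality is
  -- weighted so that the error is exactly the quadratic gain in `h1`.
  have h3 : ⟪b, D.recon (D.ζX w)⟫ - ⟪b, D.recon (D.ζX v)⟫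
      ≤ ‖b‖ ^ 2 / (2 * S.Lζ) + S.Lζ / 2 * ‖D.recon (D.ζX w) - D.recon (D.ζX v)‖ ^ 2 := by
    rw [← inner_sub_right]
    refine (real_inner_le_norm _ _).trans ?_
    generalize ‖D.recon (D.ζX w) - D.recon (D.ζX v)‖ = y
    generalize ‖b‖ = x
    have h4 : x ^ 2 / (2 * S.Lζ) + S.Lζ / 2 * y ^ 2 - x * y
        = (x - S.Lζ * y) ^ 2 / (2 * S.Lζ) := by
      field_simp
      ring
    have h5 : 0 ≤ (x - S.Lζ * y) ^ 2 / (2 * S.Lζ) := by positivity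
    linarith
  linarith

end Scheme

end GradDisc

/-! ### The gradient scheme as an instance of the abstract energy inequality. -/

namespace GradDisc

section Solution

variable {d : ℕ} {S : StefanData d} {𝒴 : Set S.L2} (D : GradDisc S 𝒴)
  {κ K : Type*} [NormedAddCommGroup K] [InnerProductSpace ℝ K]
  {Ω : Type*} {mΩ : MeasurableSpace Ω} {e : HilbertBasis κ ℝ K} (F : NoiseCoeff S e)
  {hu0 : S.u0L2 ∈ 𝒴} {P : Measure Ω} (W : Set.Icc (0 : ℝ) S.T → Ω → K)
  (u : Fin (D.N + 1) → Ω → D.X)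

/-- The index `min n N`. -/
def clamp (n : ℕ) : Fin (D.N + 1) := ⟨min n D.N, by omega⟩

theorem clamp_val (n : Fin (D.N + 1)) : D.clamp n = n := Fin.ext (min_eq_left (by omega))

theorem clamp_castSucc (n : Fin D.N) : D.clamp n = n.castSucc := D.clamp_val n.castSucc

theorem clamp_succ (n : Fin D.N) : D.clamp (n + 1) = n.succ := D.clamp_val n.succ

theorem clamp_mono : Monotone D.clamp := fun _ _ h => Fin.mk_le_mk.2 (min_le_min_right _ h)

/-- The increments of the noise over the time grid. -/
def noiseIncr (n : ℕ) (ω : Ω) : K := W (D.timeNat (n + 1)) ω - W (D.timeNat n) ω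

/-- The energy at step `n`. -/
def energyAt (n : ℕ) (ω : Ω) : ℝ := S.energy (D.recon (u (D.clamp n) ω))

/-- The stochastic forcing of step `n`. -/
def forcing (n : ℕ) (ω : Ω) : S.L2 :=
  F.f (D.recon (D.ζX (u (D.clamp n) ω))) (D.noiseIncr W n ω)

/-- The martingale increment in the energy inequality at step `n`. -/
def energyIncr (n : ℕ) (ω : Ω) : ℝ := ⟪D.forcing F W u n ω, D.recon (D.ζX (u (D.clamp n) ω))⟫

/-- The correction in the energy inequality at step `n`. -/
def energyCorr (n : ℕ) (ω : Ω) : ℝ := ‖D.forcing F W u n ω‖ ^ 2 / (2 * S.Lζ)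

/-- The dissipation at step `n`. -/
def dissipation (lo : ℝ) (n : ℕ) (ω : Ω) : ℝ :=
  lo * (D.dt * ‖D.grad (D.ζX (u (D.clamp (n + 1)) ω))‖ ^ 2)

variable {D F W u}

theorem norm_forcing_le {a : ℝ} (ha : ∀ w, ‖F.f (S.ζL2 w)‖ ^ 2 ≤ a * (S.energy w + 1))
    (n : ℕ) (ω : Ω) : ‖D.forcing F W u n ω‖ ^ 2
      ≤ a * (D.energyAt u n ω + 1) * ‖D.noiseIncr W n ω‖ ^ 2 := by
  calc ‖D.forcing F W u n ω‖ ^ 2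
      ≤ (‖F.f (D.recon (D.ζX (u (D.clamp n) ω)))‖ * ‖D.noiseIncr W n ω‖) ^ 2 :=
        pow_le_pow_left₀ (norm_nonneg _) (ContinuousLinearMap.le_opNorm _ _) 2
    _ ≤ _ := by
      rw [mul_pow, recon_ζX]
      exact mul_le_mul_of_nonneg_right (ha _) (sq_nonneg _)

/-- Young's inequality, as both squared norms grow at most linearly in the energy; hence the
martingale increment is also linear in the energy. -/
theorem norm_mul_norm_le {a : ℝ} (ha : ∀ w, ‖F.f (S.ζL2 w)‖ ^ 2 ≤ a * (S.energy w + 1))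
    (v : D.X) : ‖F.f (D.recon (D.ζX v))‖ * ‖D.recon (D.ζX v)‖
      ≤ (a / 2 + 1 / S.Lζ) * (S.energy (D.recon v) + 1) := by
  have hL : (0 : ℝ) < S.Lζ := S.Lζ_pos
  have h1 := ha (D.recon v)
  have h2 := S.norm_sq_ζL2_le (D.recon v)
  rw [← recon_ζX] at h1 h2
  have h3 : (0 : ℝ) ≤ 1 / S.Lζ := by positivity
  have h4 : 2 / (S.Lζ : ℝ) = 2 * (1 / S.Lζ) := by ring
  rw [h4] at h2
  nlinarith [sq_nonneg (‖F.f (D.recon (D.ζX v))‖ - ‖D.recon (D.ζX v)‖)]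

theorem continuous_recon_ζX : Continuous fun v : D.X => D.recon (D.ζX v) :=
  D.continuous_recon.comp D.continuous_ζX

theorem continuous_forcing [CompleteSpace K] :
    Continuous fun p : D.X × K => F.f (D.recon (D.ζX p.1)) p.2 :=
  (F.continuous_f.comp (continuous_recon_ζX.comp continuous_fst)).clm_apply continuous_snd

theorem continuous_adjoint_forcing [CompleteSpace K] : Continuous fun v : D.X =>
    (F.f (D.recon (D.ζX v))).adjoint (D.recon (D.ζX v)) := by
  exact (ContinuousLinearMap.adjoint.continuous.comp
    (F.continuous_f.comp continuous_recon_ζX)).clm_apply continuous_recon_ζX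

variable [MeasurableSpace K]

omit [NormedAddCommGroup K] [InnerProductSpace ℝ K] in
theorem measurable_noise_gridSigma {k n : ℕ} (hk : k ≤ n) :
    Measurable[D.gridSigma W (D.clamp n)] (W (D.timeNat k)) :=
  (comap_measurable (W (D.timeNat k))).mono
    (le_iSup₂_of_le (D.clamp k) (D.clamp_mono hk) le_rfl) le_rfl

variable [Countable κ] [BorelSpace K]

theorem integrable_noiseIncr {q : κ → ℝ} [IsProbabilityMeasure P]
    {𝔽 : Filtration (Set.Icc (0 : ℝ) S.T) mΩ} (hW : IsQWiener S.T_pos.le e q P 𝔽 W) {n : ℕ}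
    (h : Integrable (fun ω => ‖D.noiseIncr W n ω‖ ^ 4) P) : Integrable (D.noiseIncr W n) P := by
  have := secondCountable_of_hilbertBasis e
  have hm : Measurable (D.noiseIncr W n) := (hW.measurable _).sub (hW.measurable _)
  refine ((integrable_const (1 : ℝ)).add h).mono' hm.aestronglyMeasurable (ae_of_all _ fun ω => ?_)
  simp only [Pi.add_apply]
  nlinarith [sq_nonneg (‖D.noiseIncr W n ω‖ - 1), sq_nonneg (‖D.noiseIncr W n ω‖ ^ 2 - 1)]

/-- Increments of the discrete stochastic integral are orthogonal to the past. -/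
theorem integral_mul_energyIncr [CompleteSpace K] {q : κ → ℝ} [IsProbabilityMeasure P]
    {𝔽 : Filtration (Set.Icc (0 : ℝ) S.T) mΩ} (hW : IsQWiener S.T_pos.le e q P 𝔽 W)
    (hu : ∀ n, Measurable[D.gridSigma W n] (u n))
    {a : ℝ} (ha : ∀ w, ‖F.f (S.ζL2 w)‖ ^ 2 ≤ a * (S.energy w + 1)) {n : ℕ}
    (hint : Integrable (D.noiseIncr W n) P)
    (hle : D.gridSigma W (D.clamp n) ≤ mΩ)
    (hind : Indep (D.gridSigma W (D.clamp n))
      (MeasurableSpace.comap (D.noiseIncr W n) inferInstance) P)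
    {g : Ω → ℝ} (hg : Measurable[D.gridSigma W (D.clamp n)] g)
    (hgE : Integrable (fun ω => g ω * (D.energyAt u n ω + 1)) P) :
    ∫ ω, g ω * D.energyIncr F W u n ω ∂P = 0 := by
  have := secondCountable_of_hilbertBasis e
  -- Passing to the adjoint writes the integrand as `⟪Z, ΔW⟫` with `Z` measurable with respect to
  -- the past. By independence its mean is the inner product of the two means, and `ΔW` is centred.
  set Z : Ω → K := fun ω => g ω • (F.f (D.recon (D.ζX (u (D.clamp n) ω)))).adjoint
    (D.recon (D.ζX (u (D.clamp n) ω))) with hZ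
  have hZm : Measurable[D.gridSigma W (D.clamp n)] Z :=
    hg.smul ((continuous_adjoint_forcing (F := F)).measurable.comp (hu _))
  have hZi : Integrable Z P := by
    refine (hgE.norm.const_mul (a / 2 + 1 / S.Lζ)).mono' (hZm.mono hle le_rfl).aestronglyMeasurable
      (ae_of_all _ fun ω => ?_)
    rw [hZ, norm_smul, norm_mul]
    have h1 := (ContinuousLinearMap.le_opNorm (F.f (D.recon (D.ζX (u (D.clamp n) ω)))).adjoint
      (D.recon (D.ζX (u (D.clamp n) ω))))
    rw [LinearIsometryEquiv.norm_map] at h1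
    have h2 := h1.trans (norm_mul_norm_le ha _)
    calc _ ≤ ‖g ω‖ * ((a / 2 + 1 / S.Lζ) * (D.energyAt u n ω + 1)) :=
          mul_le_mul_of_nonneg_left h2 (norm_nonneg _)
      _ = (a / 2 + 1 / S.Lζ) * (‖g ω‖ * (D.energyAt u n ω + 1)) := by ring
      _ = _ := by
        rw [Real.norm_of_nonneg (show 0 ≤ D.energyAt u n ω + 1 by
          have := S.energy_nonneg (D.recon (u (D.clamp n) ω))
          unfold energyAt
          positivity)]
  have hI : IndepFun Z (D.noiseIncr W n) P := indep_of_indep_of_le_left hind hZm.comap_le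
  have h0 : ∫ ω, D.noiseIncr W n ω ∂P = 0 :=
    hW.integral_increment (D.timeNat_mono (Nat.le_succ n)) hint
  have h : ∫ ω, ⟪Z ω, D.noiseIncr W n ω⟫ ∂P = 0 := by
    refine (hI.integral_bilin hZi hint (innerSL ℝ)).trans ?_
    rw [h0, map_zero]
  rw [← h]
  refine integral_congr_ae (ae_of_all _ fun ω => ?_)
  simp only [hZ, energyIncr, forcing, real_inner_smul_left,
    ContinuousLinearMap.adjoint_inner_left]
  rw [real_inner_comm]

theorem measurable_energyIncr [CompleteSpace K] {m : MeasurableSpace Ω} {n : ℕ}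
    (h : Measurable[m] fun ω => (u (D.clamp n) ω, D.noiseIncr W n ω)) :
    Measurable[m] (D.energyIncr F W u n) := by
  have := secondCountable_of_hilbertBasis e
  have h1 : Continuous fun p : D.X × K => D.recon (D.ζX p.1) :=
    continuous_recon_ζX.comp continuous_fst
  have h2 : Measurable fun p : D.X × K => ⟪F.f (D.recon (D.ζX p.1)) p.2, D.recon (D.ζX p.1)⟫ :=
    (continuous_forcing.inner h1).measurable
  have h3 := h2.comp h
  simp only [Function.comp_def] at h3
  unfold energyIncr forcing
  exact h3

theorem measurable_energyCorr [CompleteSpace K] {m : MeasurableSpace Ω} {n : ℕ}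
    (h : Measurable[m] fun ω => (u (D.clamp n) ω, D.noiseIncr W n ω)) :
    Measurable[m] (D.energyCorr F W u n) := by
  have := secondCountable_of_hilbertBasis e
  have h2 : Measurable fun p : D.X × K => ‖F.f (D.recon (D.ζX p.1)) p.2‖ ^ 2 / (2 * S.Lζ) :=
    ((continuous_forcing.norm.pow 2).div_const (2 * (S.Lζ : ℝ))).measurable
  have h3 := h2.comp h
  simp only [Function.comp_def] at h3
  unfold energyCorr forcing
  exact h3

/-- The discrete energy inequality of the gradient scheme. -/
theorem energyBalance [CompleteSpace K] {q : κ → ℝ} [IsProbabilityMeasure P]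
    {𝔽 : Filtration (Set.Icc (0 : ℝ) S.T) mΩ} (hW : IsQWiener S.T_pos.le e q P 𝔽 W)
    (hsol : IsSolution D F hu0 P W u)
    {a : ℝ} (ha0 : 0 ≤ a) (ha : ∀ w, ‖F.f (S.ζL2 w)‖ ^ 2 ≤ a * (S.energy w + 1))
    {lo : ℝ} (hlo0 : 0 < lo) (hlo : ∀ G : S.L2d, lo * ‖G‖ ^ 2 ≤ S.lamInner G G)
    {c : ℝ} (hc : ∀ s t, s ≤ t → Integrable (fun ω => ‖W t ω - W s ω‖ ^ 4) P ∧
        ∫ ω, ‖W t ω - W s ω‖ ^ 4 ∂P ≤ c * (t - s : ℝ) ^ 2)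
    {A : ℝ} (hA : S.energy (D.recon (D.interp ⟨S.u0L2, hu0⟩)) ≤ A) :
    EnergyBalance P D.N A (a / 2 + 1 / S.Lζ + a / (2 * S.Lζ)) c D.dt
      (fun n => D.gridSigma W (D.clamp n)) (D.energyAt u) (D.dissipation u lo)
      (D.energyIncr F W u) (D.energyCorr F W u) (fun n ω => ‖D.noiseIncr W n ω‖) := by
  have := secondCountable_of_hilbertBasis e
  have hL : (0 : ℝ) < S.Lζ := S.Lζ_pos
  have hle : ∀ n, D.gridSigma W (D.clamp n) ≤ mΩ := fun n =>
    iSup₂_le fun k _ => (hW.measurable _).comap_le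
  have hmono : Monotone fun n => D.gridSigma W (D.clamp n) := fun m n hmn =>
    iSup₂_le fun k hk => le_iSup₂_of_le k (hk.trans (D.clamp_mono hmn)) le_rfl
  have hΔ : ∀ n, Measurable[D.gridSigma W (D.clamp (n + 1))] (D.noiseIncr W n) := fun n =>
    (measurable_noise_gridSigma le_rfl).sub (measurable_noise_gridSigma (Nat.le_succ n))
  have hΔm : ∀ n, Measurable (D.noiseIncr W n) := fun n => (hΔ n).mono (hle _) le_rfl
  have hind : ∀ n, Indep (D.gridSigma W (D.clamp n))
      (MeasurableSpace.comap (D.noiseIncr W n) inferInstance) P := fun n => by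
    refine indep_of_indep_of_le_left (hW.indep_increment D.timeNat_mono D.timeNat_zero n) ?_
    refine iSup₂_le fun k hk => ?_
    have hk' : k.1 ≤ n := (Fin.le_def.1 hk).trans (min_le_left _ _)
    refine le_iSup_of_le (⟨k.1, by omega⟩ : Fin (n + 1)) ?_
    rw [D.timeNat_val]
  have hfm : ∀ n, Measurable[D.gridSigma W (D.clamp (n + 1))]
      fun ω => (u (D.clamp n) ω, D.noiseIncr W n ω) := fun n =>
    ((hsol.adapted (D.clamp n)).mono (hmono (Nat.le_succ n)) le_rfl).prodMk (hΔ n)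
  have hEpos : ∀ n ω, 0 ≤ D.energyAt u n ω := fun n ω => S.energy_nonneg _
  have hc4 : ∀ n, Integrable (fun ω => ‖D.noiseIncr W n ω‖ ^ 4) P := fun n =>
    (hc _ _ (D.timeNat_mono (Nat.le_succ n))).1
  have hEm : ∀ n, Measurable[D.gridSigma W (D.clamp n)] (D.energyAt u n) := fun n => by
    have h := (S.continuous_energy.comp D.continuous_recon).measurable
    exact h.comp (hsol.adapted (D.clamp n))
  have hξm := fun n => measurable_energyIncr (F := F) (hfm n)
  have hηm := fun n => measurable_energyCorr (F := F) ((hfm n).mono (hle _) le_rfl)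
  have hcorr : 0 ≤ a / (2 * (S.Lζ : ℝ)) := by positivity
  have hmain : 0 ≤ a / 2 + 1 / (S.Lζ : ℝ) := by positivity
  refine
    { le := hle
      mono := hmono
      E_meas := hEm
      E_nonneg := hEpos
      G_nonneg := fun n ω => by
        have := D.dt_pos
        unfold dissipation
        positivity
      ξ_meas := fun n _ => hξm n
      η_meas := fun n _ => hηm n
      w_meas := fun n _ => (hΔm n).norm
      w_indep := fun n _ => indep_of_indep_of_le_right (hind n)
        (measurable_norm.comp (comap_measurable (D.noiseIncr W n))).comap_le
      w_four := fun n _ => hc4 n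
      w_four_le := fun n hn => by
        have h := (hc _ _ (D.timeNat_mono (Nat.le_succ n))).2
        rwa [D.timeNat_succ_sub hn] at h
      ξ_le := fun n _ ω => ?_
      η_nonneg := fun n _ ω => by
        unfold energyCorr
        positivity
      η_le := fun n _ ω => ?_
      orth := fun n _ g hg hgE => integral_mul_energyIncr hW hsol.adapted ha
        (integrable_noiseIncr hW (hc4 n)) (hle n) (hind n) hg hgE
      balance := ?_
      initial := fun ω => by
        have h0 : D.clamp 0 = 0 := D.clamp_val 0
        rw [energyAt, h0, hsol.initial]
        exact hA }
  · calc |D.energyIncr F W u n ω|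
        ≤ (‖F.f (D.recon (D.ζX (u (D.clamp n) ω)))‖ * ‖D.noiseIncr W n ω‖)
          * ‖D.recon (D.ζX (u (D.clamp n) ω))‖ :=
          (abs_real_inner_le_norm _ _).trans (mul_le_mul_of_nonneg_right
            (ContinuousLinearMap.le_opNorm _ _) (norm_nonneg _))
      _ = (‖F.f (D.recon (D.ζX (u (D.clamp n) ω)))‖ * ‖D.recon (D.ζX (u (D.clamp n) ω))‖)
          * ‖D.noiseIncr W n ω‖ := by ring
      _ ≤ (a / 2 + 1 / S.Lζ) * (D.energyAt u n ω + 1) * ‖D.noiseIncr W n ω‖ :=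
          mul_le_mul_of_nonneg_right (norm_mul_norm_le ha _) (norm_nonneg _)
      _ ≤ _ := by
          have := hEpos n ω
          refine mul_le_mul_of_nonneg_right (mul_le_mul_of_nonneg_right ?_ ?_) (norm_nonneg _)
          · exact le_add_of_nonneg_right hcorr
          · linarith
  · have h := norm_forcing_le (D := D) (W := W) (u := u) ha n ω
    have hE := hEpos n ω
    calc D.energyCorr F W u n ω
        ≤ (a * (D.energyAt u n ω + 1) * ‖D.noiseIncr W n ω‖ ^ 2) / (2 * S.Lζ) := by
          unfold energyCorr
          gcongr
      _ = a / (2 * S.Lζ) * (D.energyAt u n ω + 1) * ‖D.noiseIncr W n ω‖ ^ 2 := by ring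
      _ ≤ _ := by
          gcongr
          linarith
  · filter_upwards [hsol.scheme_ae] with ω hω n hn
    have h := hω ⟨n, hn⟩
    -- The test vector `ζ(u^(n+1))` is random, which is why the scheme is needed on one common event
    -- for all `φ`.
    have h1 := D.energy_step hlo (h (D.ζX (u (Fin.succ ⟨n, hn⟩) ω)))
    rw [← D.clamp_succ ⟨n, hn⟩, ← D.clamp_castSucc ⟨n, hn⟩, ← D.timeNat_val, ← D.timeNat_val] at h1
    have h2 : D.timeNat (D.clamp (n + 1)) = D.timeNat (n + 1) := by
      simp [timeNat, clamp]
    have h3 : D.timeNat (D.clamp n) = D.timeNat n := by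
      simp [timeNat, clamp]
    simp only [h2, h3] at h1
    exact h1

end Solution

end GradDisc

/-! ### From the second moment of the pathwise bound to the estimates. -/

theorem ennreal_rpow_le_one_add_pow (x : ℝ≥0∞) {r : ℝ} (h0 : 0 ≤ r) (h4 : r ≤ 4) :
    x ^ r ≤ 1 + x ^ 4 := by
  rcases le_total x 1 with h | h
  · exact (ENNReal.rpow_le_one h h0).trans le_self_add
  · calc x ^ r ≤ x ^ (4 : ℝ) := ENNReal.rpow_le_rpow_of_exponent_le h h4
      _ = x ^ 4 := by exact_mod_cast ENNReal.rpow_natCast x 4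
      _ ≤ _ := le_add_self

end StochStefan

end

theorem lemma3p6 {d : ℕ} (hd : 1 ≤ d) (S : StochStefan.StefanData d)
    {κ K : Type*} [Countable κ] [NormedAddCommGroup K] [InnerProductSpace ℝ K] [CompleteSpace K]
    [MeasurableSpace K] [BorelSpace K]
    (e : HilbertBasis κ ℝ K) (q : κ → ℝ) (hq : Summable fun k => q k ^ 2)
    (F : StochStefan.NoiseCoeff S e)
    (𝒴 : Set S.L2) (hY : S.Y ⊆ 𝒴) (hu0 : S.u0L2 ∈ 𝒴)
    (D : ℕ → StochStefan.GradDisc S 𝒴)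
    (hcons : StochStefan.Consistent D) (hconf : StochStefan.LimitConforming D)
    (hcomp : StochStefan.CompactSeq D) :
    ∃ C : ℝ, 0 < C ∧
      ∀ (Ω : Type*) [mΩ : MeasurableSpace Ω] (P : Measure Ω) [IsProbabilityMeasure P]
        (𝔽 : Filtration (Set.Icc (0 : ℝ) S.T) mΩ) (W : Set.Icc (0 : ℝ) S.T → Ω → K),
        StochStefan.IsQWiener S.T_pos.le e q P 𝔽 W →
        ∀ (m : ℕ) (u : Fin ((D m).N + 1) → Ω → (D m).X),
          StochStefan.IsSolution (D m) F hu0 P W u →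
          (AEMeasurable (fun ω => (⨆ n, (D m).XiInt (u n ω) ^ 2)
              + (D m).normGradL2 (fun n => (D m).ζX (u n ω)) ^ 4) P ∧
            ∫⁻ ω, ((⨆ n, (D m).XiInt (u n ω) ^ 2)
              + (D m).normGradL2 (fun n => (D m).ζX (u n ω)) ^ 4) ∂P ≤ ENNReal.ofReal C) ∧
          ∀ r : ℝ, 0 ≤ r → r ≤ 4 →
            AEMeasurable (fun ω => (D m).normLinfL2 (fun n => u n ω) ^ r) P ∧
            ∫⁻ ω, (D m).normLinfL2 (fun n => u n ω) ^ r ∂P ≤ ENNReal.ofReal C := by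
  obtain ⟨a, ha0, ha⟩ := F.exists_norm_sq_le
  obtain ⟨lo, hlo0, hlo⟩ := S.exists_le_lamInner
  obtain ⟨c, hc0, hc⟩ := StochStefan.IsQWiener.exists_fourth_moment S.T_pos.le e q hq
  obtain ⟨b, hb0, hb⟩ := S.exists_norm_sq_le
  -- Interpolants of the initial datum converge in `L²` and the energy is continuous, so the initial
  -- energies are bounded uniformly in `m`.
  obtain ⟨A, hA⟩ : ∃ A, ∀ m, S.energy ((D m).recon ((D m).interp ⟨S.u0L2, hu0⟩)) ≤ A := by
    obtain ⟨A, hA⟩ := ((S.continuous_energy.tendsto _).comp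
      (hcons.interp ⟨S.u0L2, hu0⟩)).bddAbove_range
    exact ⟨A, fun m => hA ⟨m, rfl⟩⟩
  have hL : (0 : ℝ) < S.Lζ := S.Lζ_pos
  have hT := S.T_pos
  set B : ℝ := a / 2 + 1 / S.Lζ + a / (2 * S.Lζ) with hB
  obtain ⟨M, hM⟩ : ∃ M : ℝ, M = B ^ 2 * (6 * (1 + c) + 3 * S.T * c) := ⟨_, rfl⟩
  have hM0 : 0 ≤ M := by rw [hM]; positivity
  set C₀ : ℝ := (3 * A ^ 2 + 2 * M * S.T) * Real.exp (2 * M * S.T) with hC₀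
  have hC₀0 : 0 ≤ C₀ := by positivity
  -- The first summand serves the energy and gradient estimate, the second the moments of order `r`;
  -- as both are nonnegative, their sum serves for all.
  refine ⟨(1 + 1 / lo ^ 2) * C₀ + (1 + b ^ 2 * (2 * C₀ + 2)), by positivity, ?_⟩
  intro Ω mΩ P _ 𝔽 W hW m u hu
  have H := StochStefan.GradDisc.energyBalance hW hu ha0 ha hlo0 hlo (hc Ω P 𝔽 W hW) (hA m)
  have hδ := (D m).dt_pos
  have hbound := H.integral_sq_bound_le_exp hδ hc0 (κ := M) (by rw [(D m).N_mul_dt, hM])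
  rw [(D m).N_mul_dt] at hbound
  have hZ2 := (H.memLp_bound hδ le_rfl).integrable_sq
  set Z : Ω → ℝ := StochStefan.EnergyBalance.bound A ((D m).energyIncr F W u)
    ((D m).energyCorr F W u) (D m).N with hZ
  have hum : ∀ n, Measurable (u n) := fun n =>
    (hu.adapted n).mono (iSup₂_le fun k _ => (hW.measurable _).comap_le) le_rfl
  -- A single square-integrable `Z` dominates every energy and the total dissipation; this puts the
  -- maximum over `n` inside the expectation.
  have hdiss : ∀ᵐ ω ∂P, (∀ n, S.energy ((D m).recon (u n ω)) ≤ Z ω) ∧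
      lo * ∑ n : Fin (D m).N, (D m).dt * ‖(D m).grad ((D m).ζX (u n.succ ω))‖ ^ 2 ≤ Z ω := by
    filter_upwards [H.le_bound] with ω hω
    constructor
    · intro n
      have h1 := hω n (by omega)
      have h2 : 0 ≤ ∑ i ∈ Finset.range n, (D m).dissipation u lo i ω :=
        Finset.sum_nonneg fun i _ => H.G_nonneg i ω
      have h3 := H.bound_mono ω (show (n : ℕ) ≤ (D m).N by omega)
      rw [StochStefan.GradDisc.energyAt, (D m).clamp_val] at h1
      linarith
    · have h1 := hω (D m).N le_rfl
      have h2 := H.E_nonneg (D m).N ω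
      rw [Finset.sum_range] at h1
      rw [Finset.mul_sum]
      have h3 : ∀ n : Fin (D m).N, (D m).dissipation u lo n ω
          = lo * ((D m).dt * ‖(D m).grad ((D m).ζX (u n.succ ω))‖ ^ 2) := fun n => by
        rw [StochStefan.GradDisc.dissipation, (D m).clamp_succ]
      simp only [h3] at h1
      linarith
  refine ⟨⟨?_, ?_⟩, fun r hr0 hr4 => ⟨?_, ?_⟩⟩
  · have h1 : Measurable fun ω => ⨆ n, (D m).XiInt (u n ω) ^ 2 :=
      Measurable.iSup fun n => ((D m).measurable_XiInt.comp (hum n)).pow_const 2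
    have h2 : Measurable fun ω => (D m).normGradL2 (fun n => (D m).ζX (u n ω)) ^ 4 :=
      (D m).measurable_normGradL2_four.comp
        (measurable_pi_lambda _ fun n => (D m).continuous_ζX.measurable.comp (hum n))
    exact (h1.add h2).aemeasurable
  · calc _ ≤ ∫⁻ ω, ENNReal.ofReal ((1 + 1 / lo ^ 2) * Z ω ^ 2) ∂P := by
          refine lintegral_mono_ae ?_
          filter_upwards [hdiss] with ω hω
          have h0 : (0 : ℝ) ≤ 1 / lo ^ 2 * Z ω ^ 2 := by positivity
          rw [add_mul, one_mul, ENNReal.ofReal_add (sq_nonneg _) h0]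
          refine add_le_add (iSup_le fun n => ?_) ?_
          · rw [(D m).XiInt_eq, ← ENNReal.ofReal_pow (S.energy_nonneg _)]
            exact ENNReal.ofReal_le_ofReal
              (pow_le_pow_left₀ (S.energy_nonneg _) (hω.1 n) 2)
          · refine ((D m).normGradL2_four_le _).trans (ENNReal.ofReal_le_ofReal ?_)
            have h1 : (1 : ℝ) / lo ^ 2 * Z ω ^ 2 = (Z ω / lo) ^ 2 := by ring
            rw [h1]
            refine pow_le_pow_left₀ (Finset.sum_nonneg fun n _ => by positivity) ?_ 2
            rw [le_div_iff₀ hlo0, mul_comm]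
            exact hω.2
      _ = ENNReal.ofReal (∫ ω, (1 + 1 / lo ^ 2) * Z ω ^ 2 ∂P) :=
          (ofReal_integral_eq_lintegral_ofReal (hZ2.const_mul _)
            (ae_of_all _ fun ω => by positivity)).symm
      _ ≤ _ := by
          refine ENNReal.ofReal_le_ofReal ?_
          rw [integral_const_mul]
          have h1 : (1 + 1 / lo ^ 2) * ∫ ω, Z ω ^ 2 ∂P ≤ (1 + 1 / lo ^ 2) * C₀ := by gcongr
          have h2 : 0 ≤ 1 + b ^ 2 * (2 * C₀ + 2) := by positivity
          linarith
  · exact (((D m).measurable_normLinfL2.comp (measurable_pi_lambda _ hum)).pow_const r).aemeasurable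
  · calc _ ≤ ∫⁻ ω, ENNReal.ofReal (1 + b ^ 2 * (2 * Z ω ^ 2 + 2)) ∂P := by
          refine lintegral_mono_ae ?_
          filter_upwards [hdiss] with ω hω
          refine (StochStefan.ennreal_rpow_le_one_add_pow _ hr0 hr4).trans ?_
          rw [ENNReal.ofReal_add zero_le_one (by positivity), ENNReal.ofReal_one]
          gcongr
          have hZ0 : 0 ≤ Z ω := (S.energy_nonneg _).trans (hω.1 0)
          -- Coercivity turns the energy bound into an `L²` bound; its fourth power is quadratic in
          -- `Z`, which is the moment available.
          have h1 : (D m).normLinfL2 (fun n => u n ω) ≤ ENNReal.ofReal (√(b * (Z ω + 1))) := by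
            refine ((D m).normLinfL2_le _).trans (iSup_le fun n => ?_)
            rw [← ofReal_norm]
            refine ENNReal.ofReal_le_ofReal (Real.le_sqrt_of_sq_le ((hb _).trans ?_))
            have := hω.1 n
            gcongr
          calc _ ≤ ENNReal.ofReal (√(b * (Z ω + 1))) ^ 4 := by gcongr
            _ = ENNReal.ofReal ((b * (Z ω + 1)) ^ 2) := by
              rw [← ENNReal.ofReal_pow (Real.sqrt_nonneg _), show (4 : ℕ) = 2 * 2 from rfl,
                pow_mul, Real.sq_sqrt (by positivity)]
            _ ≤ _ := by
              refine ENNReal.ofReal_le_ofReal ?_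
              rw [mul_pow]
              gcongr
              nlinarith [sq_nonneg (Z ω - 1)]
      _ = ENNReal.ofReal (∫ ω, (1 + b ^ 2 * (2 * Z ω ^ 2 + 2)) ∂P) := by
          refine (ofReal_integral_eq_lintegral_ofReal ?_
            (ae_of_all _ fun ω => by positivity)).symm
          exact (integrable_const _).add
            (((hZ2.const_mul 2).add (integrable_const _)).const_mul _)
      _ ≤ _ := by
          refine ENNReal.ofReal_le_ofReal ?_
          have h1 : Integrable (fun ω => 2 * Z ω ^ 2 + 2) P :=
            (hZ2.const_mul 2).add (integrable_const _)
          rw [integral_add (integrable_const _) (h1.const_mul _), integral_const_mul (b ^ 2),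
            integral_add (hZ2.const_mul 2) (integrable_const _), integral_const_mul 2]
          simp only [integral_const, probReal_univ, one_smul]
          have h2 : b ^ 2 * (2 * ∫ ω, Z ω ^ 2 ∂P + 2) ≤ b ^ 2 * (2 * C₀ + 2) := by gcongr
          have h3 : 0 ≤ (1 + 1 / lo ^ 2) * C₀ := by positivity
          linarith
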